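/- Let $H$ and $H'$ be complex Hilbert spaces of arbitrary dimension, with $H\neq\{0\}$, and let $p\in(1,\infty)\setminus\{2\}$. For a compact operator $a$ on a complex Hilbert space, let $\sigma_n(a)$ denote its singular values, that is, the eigenvalues of $|a|=(a^*a)^{1/2}$ repeated according to multiplicity. Let $C_p(H)$ be the space of all compact operators $a$ on $H$ with $\|a\|_p=\bigl(\sum_n\sigma_n(a)^p\bigr)^{1/p}<\infty$, and let $S(C_p(H))=\{a\in C_p(H):\|a\|_p=1\}$ be its unit sphere; define $C_p(H')$ and $S(C_p(H'))$ in the same way. Let $\mathcal U_{min}(H)$ be the set of all minimal partial isometries on $H$, that is, of all bounded operators $v$ on $H$ of rank one with $vv^*v=v$, and let $\mathbb T=\{\lambda\in\mathbb C:|\lambda|=1\}$. Let $\Delta:S(C_p(H))\to S(C_p(H'))$ be a surjective isometry, that is, a surjective map with $\|\Delta(a)-\Delta(b)\|_p=\|a-b\|_p$ for all $a,b\in S(C_p(H))$. Then one, and precisely one, of the following statements holds: (a) $\Delta(\lambda v)=\lambda\,\Delta(v)$ for every $\lambda\in\mathbb T$ and every $v\in\mathcal U_{min}(H)$; (b) $\Delta(\lambda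 v)=\overline{\lambda}\,\Delta(v)$ for every $\lambda\in\mathbb T$ and every $v\in\mathcal U_{min}(H)$. -/

import Mathlib

open scoped ENNReal NNReal ComplexConjugate

noncomputable section

/-- The quantity `∑ₙ σₙ(a) ^ p` for a compact operator `a` on a complex Hilbert space. The singular
values of `a` are the eigenvalues of `|a| = (a* a)^(1/2)`, repeated according to multiplicity, so
the sum is over all `μ ≥ 0`, weighted by the dimension of the `μ`-eigenspace of `|a|` (values `μ`
that are not eigenvalues have weight `0`, and `μ = 0` does not contribute when `p > 0`). -/
def schattenSum {H : Type*} [NormedAddCommGroup H] [InnerProductSpace ℂ H] [CompleteSpace H]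
    (p : ℝ) (a : H →L[ℂ] H) : ℝ≥0∞ :=
  ∑' μ : ℝ≥0,
    (Module.finrank ℂ
      (Module.End.eigenspace ((CFC.abs a : H →L[ℂ] H) : H →ₗ[ℂ] H) ((μ : ℝ) : ℂ)) : ℝ≥0∞) *
      (μ : ℝ≥0∞) ^ p

/-- The Schatten norm `‖a‖_p` of a compact operator `a`, with value `∞` when `a ∉ C_p(H)`. -/
def schattenENorm {H : Type*} [NormedAddCommGroup H] [InnerProductSpace ℂ H] [CompleteSpace H]
    (p : ℝ) (a : H →L[ℂ] H) : ℝ≥0∞ :=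
  schattenSum p a ^ (1 / p)

/-- The class `C_p(H)` of `p`-Schatten von Neumann operators. -/
def schattenClass (H : Type*) [NormedAddCommGroup H] [InnerProductSpace ℂ H] [CompleteSpace H]
    (p : ℝ) : Set (H →L[ℂ] H) :=
  {a | IsCompactOperator a ∧ schattenENorm p a < ∞}

/-- The unit sphere `S(C_p(H))`. -/
def schattenSphere (H : Type*) [NormedAddCommGroup H] [InnerProductSpace ℂ H] [CompleteSpace H]
    (p : ℝ) : Set (H →L[ℂ] H) :=
  {a | a ∈ schattenClass H p ∧ schattenENorm p a = 1}

/-- The set `U_min(H)` of minimal (that is, rank-one) partial isometries of `H`. -/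
def minimalPartialIsometries (H : Type*) [NormedAddCommGroup H] [InnerProductSpace ℂ H]
    [CompleteSpace H] : Set (H →L[ℂ] H) :=
  {v | v * star v * v = v ∧ Module.finrank ℂ (LinearMap.range (v : H →ₗ[ℂ] H)) = 1}

/-- `Δ` restricts to a surjective isometry `S(C_p(H)) → S(C_p(K))`, for the distances
`‖a - b‖_p`. The values of `Δ` outside the unit sphere of `C_p(H)` are irrelevant. -/
structure IsSurjectiveSphereIsometry {H K : Type*}
    [NormedAddCommGroup H] [InnerProductSpace ℂ H] [CompleteSpace H]
    [NormedAddCommGroup K] [InnerProductSpace ℂ K] [CompleteSpace K]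
    (p : ℝ) (Δ : (H →L[ℂ] H) → (K →L[ℂ] K)) : Prop where
  mapsTo : Set.MapsTo Δ (schattenSphere H p) (schattenSphere K p)
  surjOn : Set.SurjOn Δ (schattenSphere H p) (schattenSphere K p)
  isometry : ∀ a ∈ schattenSphere H p, ∀ b ∈ schattenSphere H p,
    schattenENorm p (Δ a - Δ b) = schattenENorm p (a - b)

end

noncomputable section

local notation "⟪" x ", " y "⟫" => inner ℂ x y

/-! Two operators are orthogonal when `b a* = 0` and `b* a = 0`. For `p ≠ 2` this is a metric
property of points of the unit sphere: it is the equality case of the Clarkson-McCarthy inequality,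
`‖a + b‖^p + ‖a - b‖^p = 2 (‖a‖^p + ‖b‖^p)`. By strict convexity the only point of the sphere at
distance `2` from `a` is `-a`, so `Δ` is odd, hence preserves `‖a + b‖` as well as `‖a - b‖`, and
with them orthogonality in both directions.

Let `v` be a minimal partial isometry and `|l| = 1`. A preimage `w` of `l Δ v` is orthogonal to
every minimal partial isometry orthogonal to `v`, which forces `w = c v` with `|c| = 1`. The
correspondence between `l` and `c` is isometric on the circle and fixes `1`, so it is the identity
or conjugation, for each `v` separately.

The choice does not depend on `v`. If `v` is of linear type and `w` of conjugate type, then `Δ (i v)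
- Δ (i w) = i (Δ v + Δ w)`, so `‖v - w‖ = ‖v + w‖`. When `v` and `w` share one of their two unit
vectors, this says that the other two have inner product with zero real part. Any two unit vectors
are joined by at most two steps avoiding that, so the type propagates everywhere.

The analytic input is elementary: Jensen's inequality for the weights `|⟨e_i, g_j⟩|^2`, which are
substochastic by Bessel, with its equality cases. It yields the independence of `∑ s_i^p` from the
singular value decomposition, the Clarkson-McCarthy equality case
(`comp_adjoint_eq_zero_of_clarkson`) and strict convexity (`eq_neg_of_schattenSum_sub`). -/

/-! ### Tangent-line inequalities for powers -/

theorem rpow_tangent_lt {r : ℝ} (hr : 1 < r) {x c : ℝ} (hx : 0 ≤ x) (hc : 0 ≤ c) (hxc : x ≠ c) :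
    c ^ r + r * c ^ (r - 1) * (x - c) < x ^ r := by
  rcases hc.eq_or_lt with rfl | hc
  · have hx' : 0 < x := lt_of_le_of_ne hx (Ne.symm hxc)
    rw [Real.zero_rpow (by linarith), Real.zero_rpow (by linarith)]
    simpa using Real.rpow_pos_of_pos hx' r
  · have h := one_add_mul_self_lt_rpow_one_add (s := x / c - 1) (by linarith [div_nonneg hx hc.le])
      (by rw [sub_ne_zero]; intro h; exact hxc ((div_eq_one_iff_eq hc.ne').1 h)) hr
    have h1 : 1 + (x / c - 1) = x / c := by ring
    rw [h1, Real.div_rpow hx hc.le, lt_div_iff₀ (Real.rpow_pos_of_pos hc r)] at h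
    have h2 : c ^ r = c ^ (r - 1) * c := by
      rw [← Real.rpow_add_one hc.ne']; ring_nf
    calc c ^ r + r * c ^ (r - 1) * (x - c) = (1 + r * (x / c - 1)) * c ^ r := by
          rw [h2]; field_simp
      _ < x ^ r := h

theorem rpow_tangent_le {r : ℝ} (hr : 1 < r) {x c : ℝ} (hx : 0 ≤ x) (hc : 0 ≤ c) :
    c ^ r + r * c ^ (r - 1) * (x - c) ≤ x ^ r := by
  rcases eq_or_ne x c with rfl | h
  · simp
  · exact (rpow_tangent_lt hr hx hc h).le

theorem rpow_lt_tangent {r : ℝ} (hr0 : 0 < r) (hr : r < 1) {x c : ℝ} (hx : 0 ≤ x) (hc : 0 < c)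
    (hxc : x ≠ c) : x ^ r < c ^ r + r * c ^ (r - 1) * (x - c) := by
  have h := rpow_one_add_lt_one_add_mul_self (s := x / c - 1) (by linarith [div_nonneg hx hc.le])
    (by rw [sub_ne_zero]; intro h; exact hxc ((div_eq_one_iff_eq hc.ne').1 h)) hr0 hr
  have h1 : 1 + (x / c - 1) = x / c := by ring
  rw [h1, Real.div_rpow hx hc.le, div_lt_iff₀ (Real.rpow_pos_of_pos hc r)] at h
  have h2 : c ^ r = c ^ (r - 1) * c := by
    rw [← Real.rpow_add_one hc.ne']; ring_nf
  calc x ^ r < (1 + r * (x / c - 1)) * c ^ r := h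
    _ = c ^ r + r * c ^ (r - 1) * (x - c) := by rw [h2]; field_simp

theorem rpow_le_tangent {r : ℝ} (hr0 : 0 < r) (hr : r < 1) {x c : ℝ} (hx : 0 ≤ x) (hc : 0 < c) :
    x ^ r ≤ c ^ r + r * c ^ (r - 1) * (x - c) := by
  rcases eq_or_ne x c with rfl | h
  · simp
  · exact (rpow_lt_tangent hr0 hr hx hc h).le

/-! ### Jensen's inequality for weights of total mass at most one -/

section Jensen

variable {ι : Type*} {w t : ι → ℝ} {W τ ρ r : ℝ}

theorem hasSum_tangent_gap (hW : HasSum w W) (hτ : HasSum (fun i => w i * t i) τ)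
    (hρ : HasSum (fun i => w i * t i ^ r) ρ) (c d : ℝ) :
    HasSum (fun i => w i * (t i ^ r - (c + d * (t i - τ)))) (ρ - (c * W + d * (τ - W * τ))) := by
  have h := hρ.sub ((hW.mul_left c).add ((hτ.sub (hW.mul_right τ)).mul_left d))
  have h1 : (fun i => w i * (t i ^ r - (c + d * (t i - τ)))) =
      fun i => w i * t i ^ r - (c * w i + d * (w i * t i - w i * τ)) := by
    funext i
    ring
  rw [h1]
  exact h

/-- Sum the tangent inequality at `τ`. Missing mass only adds the nonnegative slack `τ ^ r * ((1 -
W) * (r - 1))`, and equality makes every weighted gap vanish. -/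
theorem rpow_sum_le_of_one_lt (hr : 1 < r) (hw : ∀ i, 0 ≤ w i) (ht : ∀ i, 0 ≤ t i) (hW1 : W ≤ 1)
    (hW : HasSum w W) (hτ : HasSum (fun i => w i * t i) τ)
    (hρ : HasSum (fun i => w i * t i ^ r) ρ) :
    τ ^ r ≤ ρ ∧ (τ ^ r = ρ → ∀ i, w i ≠ 0 → t i = τ) := by
  have hτ0 : 0 ≤ τ := hτ.nonneg fun i => mul_nonneg (hw i) (ht i)
  have hg := hasSum_tangent_gap hW hτ hρ (τ ^ r) (r * τ ^ (r - 1))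
  have hg0 : ∀ i, 0 ≤ w i * (t i ^ r - (τ ^ r + r * τ ^ (r - 1) * (t i - τ))) := fun i =>
    mul_nonneg (hw i) (sub_nonneg.2 (rpow_tangent_le hr (ht i) hτ0))
  have h0 := hg.nonneg hg0
  have h2 : τ ^ r = τ ^ (r - 1) * τ := by
    rw [← Real.rpow_add_one' hτ0 (by linarith)]; ring_nf
  have h3 : ρ - (τ ^ r * W + r * τ ^ (r - 1) * (τ - W * τ)) =
      ρ - τ ^ r - τ ^ r * ((1 - W) * (r - 1)) := by
    rw [h2]; ring
  have h4 : 0 ≤ τ ^ r * ((1 - W) * (r - 1)) :=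
    mul_nonneg (Real.rpow_nonneg hτ0 r) (mul_nonneg (by linarith) (by linarith))
  refine ⟨by linarith, fun h i hi => ?_⟩
  have h5 : ρ - (τ ^ r * W + r * τ ^ (r - 1) * (τ - W * τ)) = 0 := by linarith
  rw [h5] at hg
  have h6 := congr_fun ((hasSum_zero_iff_of_nonneg hg0).1 hg) i
  by_contra hne
  have h7 := rpow_tangent_lt hr (ht i) hτ0 hne
  rcases mul_eq_zero.1 h6 with h6 | h6
  · exact hi h6
  · linarith

theorem le_rpow_sum_of_lt_one (hr0 : 0 < r) (hr : r < 1) (hw : ∀ i, 0 ≤ w i) (ht : ∀ i, 0 ≤ t i)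
    (hW1 : W ≤ 1) (hW : HasSum w W) (hτ : HasSum (fun i => w i * t i) τ)
    (hρ : HasSum (fun i => w i * t i ^ r) ρ) :
    ρ ≤ τ ^ r ∧ (ρ = τ ^ r → ∀ i, w i ≠ 0 → t i = τ) := by
  have hτ0 : 0 ≤ τ := hτ.nonneg fun i => mul_nonneg (hw i) (ht i)
  -- For `r < 1` there is no tangent at `0`, so `τ = 0` is treated apart: then every `t i` of
  -- non-zero weight is zero.
  rcases hτ0.eq_or_lt with h0 | hτ0
  · subst h0
    have h1 := (hasSum_zero_iff_of_nonneg fun i => mul_nonneg (hw i) (ht i)).1 hτ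
    have h2 : ∀ i, w i ≠ 0 → t i = 0 := fun i hi =>
      (mul_eq_zero.1 (congr_fun h1 i)).resolve_left hi
    have h3 : (fun i => w i * t i ^ r) = fun _ => 0 := by
      funext i
      by_cases hi : w i = 0
      · simp [hi]
      · simp [h2 i hi, Real.zero_rpow hr0.ne']
    rw [h3] at hρ
    rw [hρ.unique hasSum_zero, Real.zero_rpow hr0.ne']
    exact ⟨le_rfl, fun _ => h2⟩
  have hg := (hasSum_tangent_gap hW hτ hρ (τ ^ r) (r * τ ^ (r - 1))).neg
  have hg0 : ∀ i, 0 ≤ -(w i * (t i ^ r - (τ ^ r + r * τ ^ (r - 1) * (t i - τ)))) := fun i => by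
    rw [← mul_neg]
    exact mul_nonneg (hw i) (by linarith [rpow_le_tangent hr0 hr (ht i) hτ0])
  have h0 := hg.nonneg hg0
  have h2 : τ ^ r = τ ^ (r - 1) * τ := by
    rw [← Real.rpow_add_one hτ0.ne']; ring_nf
  have h3 : -(ρ - (τ ^ r * W + r * τ ^ (r - 1) * (τ - W * τ))) =
      τ ^ r - ρ - τ ^ r * ((1 - W) * (1 - r)) := by
    rw [h2]; ring
  have h4 : 0 ≤ τ ^ r * ((1 - W) * (1 - r)) :=
    mul_nonneg (Real.rpow_nonneg hτ0.le r) (mul_nonneg (by linarith) (by linarith))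
  refine ⟨by linarith, fun h i hi => ?_⟩
  have h5 : -(ρ - (τ ^ r * W + r * τ ^ (r - 1) * (τ - W * τ))) = 0 := by linarith
  rw [h5] at hg
  have h6 := neg_eq_zero.1 (congr_fun ((hasSum_zero_iff_of_nonneg hg0).1 hg) i)
  by_contra hne
  have h7 := rpow_lt_tangent hr0 hr (ht i) hτ0 hne
  rcases mul_eq_zero.1 h6 with h6 | h6
  · exact hi h6
  · linarith

end Jensen

/-! ### Power sums under substochastic matrices -/

theorem ENNReal.eq_of_tsum_eq {ι : Type*} {f g : ι → ℝ≥0∞} (hle : ∀ i, f i ≤ g i)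
    (hsum : ∑' i, g i ≤ ∑' i, f i) (hf : ∑' i, f i ≠ ∞) (i : ι) : f i = g i := by
  by_contra h
  exact absurd (ENNReal.tsum_lt_tsum hf hle (lt_of_le_of_ne (hle i) h)) (not_lt.2 hsum)

section Substochastic

variable {ι κ : Type*} {w : ι → κ → ℝ} {t : ι → ℝ} {M r : ℝ}

/-- The sum `∑ tᵢ ^ p` with values in `[0, ∞]`. -/
def powSum (p : ℝ) (t : ι → ℝ) : ℝ≥0∞ := ∑' i, ENNReal.ofReal (t i ^ p)

theorem summable_mul_of_le {w t : ι → ℝ} (hw : ∀ i, 0 ≤ w i) (ht : ∀ i, 0 ≤ t i)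
    (hM : ∀ i, t i ≤ M) (hs : Summable w) : Summable fun i => w i * t i :=
  Summable.of_nonneg_of_le (fun i => mul_nonneg (hw i) (ht i))
    (fun i => mul_le_mul_of_nonneg_left (hM i) (hw i)) (hs.mul_right M)

theorem tsum_ofReal_mul_rpow (hw : ∀ i j, 0 ≤ w i j) (ht : ∀ i, 0 ≤ t i) (hM : ∀ i, t i ≤ M)
    (hr : 0 < r) (hrow : ∀ i, Summable (w i)) (hcol : ∀ j, Summable fun i => w i j) :
    ∑' j, ENNReal.ofReal (∑' i, w i j * t i ^ r) =
      ∑' i, ENNReal.ofReal (∑' j, w i j) * ENNReal.ofReal (t i ^ r) := by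
  have hr0 : ∀ i, 0 ≤ t i ^ r := fun i => Real.rpow_nonneg (ht i) r
  have h1 : ∀ j, ENNReal.ofReal (∑' i, w i j * t i ^ r) =
      ∑' i, ENNReal.ofReal (w i j) * ENNReal.ofReal (t i ^ r) := fun j => by
    rw [ENNReal.ofReal_tsum_of_nonneg (fun i => mul_nonneg (hw i j) (hr0 i))
      (summable_mul_of_le (fun i => hw i j) hr0
        (fun i => Real.rpow_le_rpow (ht i) (hM i) hr.le) (hcol j))]
    exact tsum_congr fun i => ENNReal.ofReal_mul (hw i j)
  simp_rw [h1]
  rw [ENNReal.tsum_comm]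
  refine tsum_congr fun i => ?_
  rw [ENNReal.tsum_mul_right, ENNReal.ofReal_tsum_of_nonneg (hw i) (hrow i)]

/-- Jensen in each column, then exchange of the sums and the bound on the rows. Equality overall
forces equality at both stages. -/
theorem powSum_substochastic_le (hr : 1 < r) (hw : ∀ i j, 0 ≤ w i j) (ht : ∀ i, 0 ≤ t i)
    (hM : ∀ i, t i ≤ M) (hrow : ∀ i, Summable (w i)) (hrow1 : ∀ i, ∑' j, w i j ≤ 1)
    (hcol : ∀ j, Summable fun i => w i j) (hcol1 : ∀ j, ∑' i, w i j ≤ 1) :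
    powSum r (fun j => ∑' i, w i j * t i) ≤ powSum r t ∧
    (powSum r (fun j => ∑' i, w i j * t i) = powSum r t → powSum r t ≠ ∞ →
      (∀ i j, w i j ≠ 0 → t i = ∑' i, w i j * t i) ∧ ∀ i, 0 < t i → ∑' j, w i j = 1) := by
  have hr0 : ∀ i, 0 ≤ t i ^ r := fun i => Real.rpow_nonneg (ht i) r
  have hJ := fun j => rpow_sum_le_of_one_lt hr (fun i => hw i j) ht (hcol1 j) (hcol j).hasSum
    (summable_mul_of_le (fun i => hw i j) ht hM (hcol j)).hasSum
    (summable_mul_of_le (fun i => hw i j) hr0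
        (fun i => Real.rpow_le_rpow (ht i) (hM i) (by linarith)) (hcol j)).hasSum
  have hA := fun j => ENNReal.ofReal_le_ofReal (hJ j).1
  have hB : ∀ i, ENNReal.ofReal (∑' j, w i j) * ENNReal.ofReal (t i ^ r) ≤
      ENNReal.ofReal (t i ^ r) := fun i =>
    mul_le_of_le_one_left zero_le (by simpa using ENNReal.ofReal_le_ofReal (hrow1 i))
  have hAB := tsum_ofReal_mul_rpow hw ht hM (by linarith : 0 < r) hrow hcol
  have hA' := ENNReal.tsum_le_tsum hA
  have hB' := ENNReal.tsum_le_tsum hB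
  refine ⟨hA'.trans (hAB.trans_le hB'), fun heq hfin => ⟨fun i j hij => ?_, fun i hi => ?_⟩⟩
  · have h1 := ENNReal.eq_of_tsum_eq hA ((hAB.trans_le hB').trans heq.ge) (by
      rw [powSum] at heq; rw [heq]; exact hfin) j
    rw [ENNReal.ofReal_eq_ofReal_iff
      (Real.rpow_nonneg (tsum_nonneg fun i => mul_nonneg (hw i j) (ht i)) r)
      (tsum_nonneg fun i => mul_nonneg (hw i j) (hr0 i))] at h1
    exact (hJ j).2 h1 i hij
  · have h1 := ENNReal.eq_of_tsum_eq hB (heq.ge.trans (hA'.trans hAB.le))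
      (ne_top_of_le_ne_top hfin hB') i
    rw [← ENNReal.ofReal_mul (tsum_nonneg (hw i)), ENNReal.ofReal_eq_ofReal_iff
      (mul_nonneg (tsum_nonneg (hw i)) (hr0 i)) (hr0 i)] at h1
    exact mul_right_cancel₀ (Real.rpow_pos_of_pos hi r).ne' (h1.trans (one_mul _).symm)

/-- Jensen now points the other way, so a row bound would be useless and the rows must sum to
exactly one. -/
theorem le_powSum_substochastic (hr0 : 0 < r) (hr : r < 1) (hw : ∀ i j, 0 ≤ w i j)
    (ht : ∀ i, 0 ≤ t i) (hM : ∀ i, t i ≤ M) (hrow : ∀ i, Summable (w i))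
    (hrow1 : ∀ i, ∑' j, w i j = 1) (hcol : ∀ j, Summable fun i => w i j)
    (hcol1 : ∀ j, ∑' i, w i j ≤ 1) :
    powSum r t ≤ powSum r (fun j => ∑' i, w i j * t i) ∧
    (powSum r t = powSum r (fun j => ∑' i, w i j * t i) → powSum r t ≠ ∞ →
      ∀ i j, w i j ≠ 0 → t i = ∑' i, w i j * t i) := by
  have hrn : ∀ i, 0 ≤ t i ^ r := fun i => Real.rpow_nonneg (ht i) r
  have hJ := fun j => le_rpow_sum_of_lt_one hr0 hr (fun i => hw i j) ht (hcol1 j) (hcol j).hasSum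
    (summable_mul_of_le (fun i => hw i j) ht hM (hcol j)).hasSum
    (summable_mul_of_le (fun i => hw i j) hrn
        (fun i => Real.rpow_le_rpow (ht i) (hM i) hr0.le) (hcol j)).hasSum
  have hA := fun j => ENNReal.ofReal_le_ofReal (hJ j).1
  have hAB := tsum_ofReal_mul_rpow hw ht hM hr0 hrow hcol
  simp only [hrow1, ENNReal.ofReal_one, one_mul] at hAB
  have hA' := ENNReal.tsum_le_tsum hA
  refine ⟨hAB.symm.trans_le hA', fun heq hfin i j hij => ?_⟩
  have h1 := ENNReal.eq_of_tsum_eq hA (heq.ge.trans hAB.ge) (by rw [hAB]; exact hfin) j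
  rw [ENNReal.ofReal_eq_ofReal_iff (tsum_nonneg fun i => mul_nonneg (hw i j) (hrn i))
    (Real.rpow_nonneg (tsum_nonneg fun i => mul_nonneg (hw i j) (ht i)) r)] at h1
  exact (hJ j).2 h1 i hij

end Substochastic

/-! ### Squared inner products of two orthonormal families -/

section Bessel

variable {E : Type*} [NormedAddCommGroup E] [InnerProductSpace ℂ E] [CompleteSpace E]
  {ι κ : Type*} {e : ι → E} {g : κ → E}

theorem Orthonormal.exists_hasSum_inner_smul (he : Orthonormal ℂ e) (x : E) :
    ∃ z, HasSum (fun i => ⟪e i, x⟫ • e i) z ∧ ∀ i, ⟪e i, x - z⟫ = 0 := by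
  have hs : Summable fun i => ⟪e i, x⟫ • e i :=
    (he.orthogonalFamily.summable_iff_norm_sq_summable fun i => ⟪e i, x⟫).2
      (he.inner_products_summable x)
  refine ⟨_, hs.hasSum, fun i => ?_⟩
  have h1 := hs.hasSum.mapL (innerSL ℂ (e i))
  have h2 : HasSum (fun j => innerSL ℂ (e i) (⟪e j, x⟫ • e j))
      (innerSL ℂ (e i) (⟪e i, x⟫ • e i)) := by
    refine hasSum_single i fun j hj => ?_
    simp [he.2 hj.symm]
  have h3 := h1.unique h2
  simp only [innerSL_apply_apply, inner_smul_right, inner_self_eq_norm_sq_to_K, he.1 i] at h3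
  rw [inner_sub_right, h3]
  simp

/-- Parseval; the hypothesis expresses that `y` lies in the closed span of `e`. -/
theorem Orthonormal.hasSum_norm_inner_sq (he : Orthonormal ℂ e) {y : E}
    (hy : ∀ x, (∀ i, ⟪e i, x⟫ = 0) → ⟪y, x⟫ = 0) :
    HasSum (fun i => ‖⟪e i, y⟫‖ ^ 2) (‖y‖ ^ 2) := by
  obtain ⟨z, hz, hz'⟩ := he.exists_hasSum_inner_smul y
  have h1 : ⟪y - z, z⟫ = 0 := by
    have h2 := hz.mapL (innerSL ℂ (y - z))
    simp only [innerSL_apply_apply, inner_smul_right, inner_eq_zero_symm.1 (hz' _), mul_zero] at h2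
    exact h2.unique hasSum_zero
  have h2 : ⟪y - z, y - z⟫ = 0 := by
    rw [inner_sub_right, h1, inner_eq_zero_symm.1 (hy _ hz'), sub_zero]
  have h3 : y = z := sub_eq_zero.1 (inner_self_eq_zero.1 h2)
  rw [← h3] at hz
  have h4 := Complex.hasSum_re (hz.mapL (innerSL ℂ y))
  rw [innerSL_apply_apply, inner_self_eq_norm_sq_to_K] at h4
  have h5 : (fun i => ‖⟪e i, y⟫‖ ^ 2) = fun i => (innerSL ℂ y (⟪e i, y⟫ • e i)).re := by
    funext i
    rw [innerSL_apply_apply, inner_smul_right]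
    refine Eq.trans ?_ (inner_mul_symm_re_eq_norm (𝕜 := ℂ) (e i) y).symm
    rw [norm_mul, norm_inner_symm y, sq]
  rw [h5]
  convert h4 using 1
  norm_cast

omit [CompleteSpace E] in
theorem Orthonormal.summable_norm_inner_sq (he : Orthonormal ℂ e) (x : E) :
    Summable fun i => ‖⟪x, e i⟫‖ ^ 2 := by
  simpa only [norm_inner_symm x] using he.inner_products_summable x

omit [CompleteSpace E] in
theorem Orthonormal.tsum_norm_inner_sq_le_one (he : Orthonormal ℂ e) {x : E} (hx : ‖x‖ = 1) :
    ∑' i, ‖⟪e i, x⟫‖ ^ 2 ≤ 1 := by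
  simpa [hx] using he.tsum_inner_products_le x

omit [CompleteSpace E] in
theorem Orthonormal.powSum_inner_le (he : Orthonormal ℂ e) (hg : Orthonormal ℂ g) {t : ι → ℝ}
    {M r : ℝ} (hr : 1 < r) (ht : ∀ i, 0 ≤ t i) (hM : ∀ i, t i ≤ M) :
    powSum r (fun j => ∑' i, ‖⟪e i, g j⟫‖ ^ 2 * t i) ≤ powSum r t ∧
    (powSum r (fun j => ∑' i, ‖⟪e i, g j⟫‖ ^ 2 * t i) = powSum r t → powSum r t ≠ ∞ →
      (∀ i j, ⟪e i, g j⟫ ≠ 0 → t i = ∑' i, ‖⟪e i, g j⟫‖ ^ 2 * t i) ∧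
        ∀ i, 0 < t i → ∑' j, ‖⟪e i, g j⟫‖ ^ 2 = 1) := by
  have h := powSum_substochastic_le (w := fun i j => ‖⟪e i, g j⟫‖ ^ 2) hr
    (fun i j => by positivity) ht hM
    (fun i => hg.summable_norm_inner_sq (e i))
    (fun i => by simpa only [norm_inner_symm (e i)] using hg.tsum_norm_inner_sq_le_one (he.1 i))
    (fun j => he.inner_products_summable (g j)) (fun j => he.tsum_norm_inner_sq_le_one (hg.1 j))
  refine ⟨h.1, fun h1 h2 => ⟨fun i j hij => ?_, (h.2 h1 h2).2⟩⟩
  exact (h.2 h1 h2).1 i j (by simpa using hij)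

theorem Orthonormal.le_powSum_inner (he : Orthonormal ℂ e) (hg : Orthonormal ℂ g) {t : ι → ℝ}
    {M r : ℝ} (hr0 : 0 < r) (hr : r < 1) (ht : ∀ i, 0 ≤ t i) (hM : ∀ i, t i ≤ M)
    (hspan : ∀ i x, (∀ j, ⟪g j, x⟫ = 0) → ⟪e i, x⟫ = 0) :
    powSum r t ≤ powSum r (fun j => ∑' i, ‖⟪e i, g j⟫‖ ^ 2 * t i) ∧
    (powSum r t = powSum r (fun j => ∑' i, ‖⟪e i, g j⟫‖ ^ 2 * t i) → powSum r t ≠ ∞ →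
      ∀ i j, ⟪e i, g j⟫ ≠ 0 → t i = ∑' i, ‖⟪e i, g j⟫‖ ^ 2 * t i) := by
  have h := le_powSum_substochastic (w := fun i j => ‖⟪e i, g j⟫‖ ^ 2) hr0 hr
    (fun i j => by positivity) ht hM
    (fun i => hg.summable_norm_inner_sq (e i))
    (fun i => by
      simpa only [norm_inner_symm (e i), he.1 i, one_pow] using
        (hg.hasSum_norm_inner_sq (hspan i)).tsum_eq)
    (fun j => he.inner_products_summable (g j)) (fun j => he.tsum_norm_inner_sq_le_one (hg.1 j))
  exact ⟨h.1, fun h1 h2 i j hij => h.2 h1 h2 i j (by simpa using hij)⟩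

end Bessel

/-! ### Singular value decompositions and their power sums -/

theorem powSum_half_sq {ι : Type*} {s : ι → ℝ} (hs : ∀ i, 0 ≤ s i) (p : ℝ) :
    powSum (p / 2) (fun i => s i ^ 2) = powSum p s := by
  refine tsum_congr fun i => ?_
  rw [← Real.rpow_natCast_mul (hs i)]
  congr 2
  push_cast
  ring

/-- A singular value decomposition `T = ∑ sᵢ ⟨eᵢ, ·⟩ fᵢ` with positive `sᵢ` and orthonormal
families `e` and `f`. -/
structure IsSVD {E F ι : Type*} [NormedAddCommGroup E] [InnerProductSpace ℂ E]
    [NormedAddCommGroup F] [InnerProductSpace ℂ F] (T : E →L[ℂ] F) (s : ι → ℝ)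
    (e : ι → E) (f : ι → F) : Prop where
  left : Orthonormal ℂ e
  right : Orthonormal ℂ f
  pos : ∀ i, 0 < s i
  map : ∀ i, T (e i) = (s i : ℂ) • f i
  ker : ∀ x, (∀ i, ⟪e i, x⟫ = 0) → T x = 0

open ContinuousLinearMap Module.End InnerProductSpace

namespace IsSVD

variable {E F ι κ : Type*} [NormedAddCommGroup E] [InnerProductSpace ℂ E] [CompleteSpace E]
  [NormedAddCommGroup F] [InnerProductSpace ℂ F] {T : E →L[ℂ] F} {s : ι → ℝ}
  {e : ι → E} {f : ι → F} {g : κ → E} {s' : κ → ℝ} {e' : κ → E} {f' : κ → F} {p : ℝ}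

omit [CompleteSpace E] in
theorem norm_map (h : IsSVD T s e f) (i : ι) : ‖T (e i)‖ = s i := by
  rw [h.map, norm_smul, h.right.1, mul_one, Complex.norm_real, Real.norm_of_nonneg (h.pos i).le]

omit [CompleteSpace E] in
theorem le_norm (h : IsSVD T s e f) (i : ι) : s i ≤ ‖T‖ := by
  rw [← h.norm_map i]
  simpa [h.left.1 i] using T.le_opNorm (e i)

theorem hasSum_apply (h : IsSVD T s e f) (x : E) :
    HasSum (fun i => (⟪e i, x⟫ * s i) • f i) (T x) := by
  obtain ⟨z, hz, hz'⟩ := h.left.exists_hasSum_inner_smul x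
  have h1 : T x = T z := by
    rw [← sub_eq_zero, ← map_sub]
    exact h.ker _ hz'
  rw [h1]
  have h2 := hz.mapL T
  simpa only [map_smul, h.map, smul_smul] using h2

theorem inner_apply (h : IsSVD T s e f) (i : ι) (x : E) : ⟪f i, T x⟫ = s i * ⟪e i, x⟫ := by
  have h1 := (h.hasSum_apply x).mapL (innerSL ℂ (f i))
  have h2 : HasSum (fun j => innerSL ℂ (f i) ((⟪e j, x⟫ * s j) • f j))
      (innerSL ℂ (f i) ((⟪e i, x⟫ * s i) • f i)) := by
    refine hasSum_single i fun j hj => ?_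
    simp [h.right.2 hj.symm]
  have h3 := h1.unique h2
  simp only [innerSL_apply_apply, inner_smul_right, inner_self_eq_norm_sq_to_K, h.right.1 i] at h3
  rw [h3]
  simp [mul_comm]

theorem adjoint [CompleteSpace F] (h : IsSVD T s e f) : IsSVD (adjoint T) s f e where
  left := h.right
  right := h.left
  pos := h.pos
  map i := by
    refine ext_inner_right ℂ fun x => ?_
    rw [adjoint_inner_left, h.inner_apply, inner_smul_left, Complex.conj_ofReal]
  ker y hy := by
    refine ext_inner_right ℂ fun x => ?_
    rw [adjoint_inner_left, inner_zero_left]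
    have h1 := (h.hasSum_apply x).mapL (innerSL ℂ y)
    simp only [innerSL_apply_apply, inner_smul_right, inner_eq_zero_symm.1 (hy _), mul_zero] at h1
    exact h1.unique hasSum_zero

theorem hasSum_norm_sq [CompleteSpace F] (h : IsSVD T s e f) (x : E) :
    HasSum (fun i => ‖⟪e i, x⟫‖ ^ 2 * s i ^ 2) (‖T x‖ ^ 2) := by
  have h1 := h.right.hasSum_norm_inner_sq (y := T x) fun y hy => by
    rw [← adjoint_inner_right, h.adjoint.ker y hy, inner_zero_right]
  convert h1 using 2 with i
  rw [h.inner_apply, norm_mul, Complex.norm_real, Real.norm_of_nonneg (h.pos i).le, mul_pow,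
    mul_comm]

theorem inner_eq_zero_of_apply_eq_zero [CompleteSpace F] (h : IsSVD T s e f) {x : E}
    (hx : T x = 0) (i : ι) :
    ⟪e i, x⟫ = 0 := by
  have h1 := h.inner_apply i x
  rw [hx, inner_zero_right] at h1
  exact (mul_eq_zero.1 h1.symm).resolve_left (Complex.ofReal_ne_zero.2 (h.pos i).ne')

/-- Here `‖T (g j)‖ ^ 2` is the average of the `s i ^ 2` with weights `‖⟪e i, g j⟫‖ ^ 2`, so the
substochastic bound applies with exponent `p / 2`. -/
theorem powSum_norm_le [CompleteSpace F] (h : IsSVD T s e f) (hp : 2 < p) (hg : Orthonormal ℂ g) :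
    powSum p (fun j => ‖T (g j)‖) ≤ powSum p s ∧
    (powSum p (fun j => ‖T (g j)‖) = powSum p s → powSum p s ≠ ∞ →
      ∀ i j, ⟪e i, g j⟫ ≠ 0 → s i = ‖T (g j)‖) := by
  have h1 := h.left.powSum_inner_le hg (t := fun i => s i ^ 2) (M := ‖T‖ ^ 2) (r := p / 2)
    (by linarith) (fun i => sq_nonneg _)
    (fun i => pow_le_pow_left₀ (h.pos i).le (h.le_norm i) 2)
  simp only [(h.hasSum_norm_sq _).tsum_eq, powSum_half_sq (fun j => norm_nonneg (T (g j))),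
    powSum_half_sq (fun i => (h.pos i).le)] at h1
  refine ⟨h1.1, fun h2 h3 i j hij => ?_⟩
  exact (pow_left_inj₀ (h.pos i).le (norm_nonneg _) two_ne_zero).1 ((h1.2 h2 h3).1 i j hij)

theorem le_powSum_norm [CompleteSpace F] (h : IsSVD T s e f) (hp0 : 0 < p) (hp : p < 2)
    (hg : Orthonormal ℂ g) (hker : ∀ x, (∀ j, ⟪g j, x⟫ = 0) → T x = 0) :
    powSum p s ≤ powSum p (fun j => ‖T (g j)‖) ∧
    (powSum p s = powSum p (fun j => ‖T (g j)‖) → powSum p s ≠ ∞ →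
      ∀ i j, ⟪e i, g j⟫ ≠ 0 → s i = ‖T (g j)‖) := by
  have h1 := h.left.le_powSum_inner hg (t := fun i => s i ^ 2) (M := ‖T‖ ^ 2) (r := p / 2)
    (by linarith) (by linarith) (fun i => sq_nonneg _)
    (fun i => pow_le_pow_left₀ (h.pos i).le (h.le_norm i) 2)
    (fun i x hx => h.inner_eq_zero_of_apply_eq_zero (hker x hx) i)
  simp only [(h.hasSum_norm_sq _).tsum_eq, powSum_half_sq (fun j => norm_nonneg (T (g j))),
    powSum_half_sq (fun i => (h.pos i).le)] at h1
  refine ⟨h1.1, fun h2 h3 i j hij => ?_⟩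
  exact (pow_left_inj₀ (h.pos i).le (norm_nonneg _) two_ne_zero).1 (h1.2 h2 h3 i j hij)

/-- The singular values of one decomposition are the norms of the images of its own right singular
vectors, which can be tested against the other decomposition. -/
theorem powSum_le_powSum [CompleteSpace F] (h : IsSVD T s e f) (h' : IsSVD T s' e' f')
    (hp0 : 0 < p) (hp2 : p ≠ 2) : powSum p s ≤ powSum p s' := by
  rcases hp2.lt_or_gt with hp | hp
  · simpa only [h'.norm_map] using (h.le_powSum_norm hp0 hp h'.left h'.ker).1
  · simpa only [h.norm_map] using (h'.powSum_norm_le hp h.left).1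

theorem powSum_eq [CompleteSpace F] (h : IsSVD T s e f) (h' : IsSVD T s' e' f')
    (hp0 : 0 < p) (hp2 : p ≠ 2) : powSum p s = powSum p s' :=
  (h.powSum_le_powSum h' hp0 hp2).antisymm (h'.powSum_le_powSum h hp0 hp2)

omit [CompleteSpace E] in
theorem const_smul (h : IsSVD T s e f) {c : ℂ} (hc : c ≠ 0) :
    IsSVD (c • T) (fun i => ‖c‖ * s i) e (fun i => (c / ‖c‖) • f i) where
  left := h.left
  right := by
    have hc' : (‖c‖ : ℂ) ≠ 0 := by simpa using hc
    refine ⟨fun i => ?_, fun i j hij => ?_⟩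
    · rw [norm_smul, h.right.1, mul_one, norm_div, Complex.norm_real, norm_norm,
        div_self (norm_ne_zero_iff.2 hc)]
    · beta_reduce
      rw [inner_smul_left, inner_smul_right, h.right.2 hij, mul_zero, mul_zero]
  pos i := mul_pos (norm_pos_iff.2 hc) (h.pos i)
  map i := by
    have hc' : (‖c‖ : ℂ) ≠ 0 := by simpa using hc
    rw [smul_apply, h.map, smul_smul, smul_smul]
    congr 1
    push_cast
    field_simp
  ker x hx := by rw [smul_apply, h.ker x hx, smul_zero]

omit [CompleteSpace E] in
theorem powSum_const_mul (h : IsSVD T s e f) {c : ℝ} (hc : 0 ≤ c) :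
    powSum p (fun i => c * s i) = ENNReal.ofReal (c ^ p) * powSum p s := by
  rw [powSum, powSum, ← ENNReal.tsum_mul_left]
  refine tsum_congr fun i => ?_
  rw [Real.mul_rpow hc (h.pos i).le, ENNReal.ofReal_mul (Real.rpow_nonneg hc p)]

end IsSVD

/-! ### Existence of singular value decompositions of compact operators -/

section Existence

variable {E F : Type*} [NormedAddCommGroup E] [InnerProductSpace ℂ E] [CompleteSpace E]
  [NormedAddCommGroup F] [InnerProductSpace ℂ F] [CompleteSpace F] {T : E →L[ℂ] F}

/-- Indices of a singular value decomposition of `T`: pairs of a positive `μ` and a natural number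
below the dimension of the `μ ^ 2`-eigenspace of `T* T`. -/
abbrev SVDIndex (T : E →L[ℂ] F) : Type :=
  Σ μ : {μ : ℝ≥0 // μ ≠ 0}, Fin (Module.finrank ℂ
    (eigenspace ((adjoint T ∘L T : E →L[ℂ] E) : E →ₗ[ℂ] E) (((μ : ℝ≥0) : ℝ) ^ 2 : ℂ)))

theorem adjoint_comp_self_symmetric (T : E →L[ℂ] F) :
    ((adjoint T ∘L T : E →L[ℂ] E) : E →ₗ[ℂ] E).IsSymmetric := fun x y => by
  simp [adjoint_inner_left, adjoint_inner_right]

theorem apply_eq_zero_of_adjoint_comp_self {x : E} (h : adjoint T (T x) = 0) : T x = 0 := by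
  rw [← inner_self_eq_zero (𝕜 := ℂ), ← adjoint_inner_left, h, inner_zero_left]

theorem IsCompactOperator.exists_isSVD (hT : IsCompactOperator T) :
    ∃ (e : SVDIndex T → E) (f : SVDIndex T → F),
      IsSVD T (fun i => ((i.1 : ℝ≥0) : ℝ)) e f := by
  set C : E →L[ℂ] E := adjoint T ∘L T with hC
  have hCc : IsCompactOperator C := hT.clm_comp (adjoint T)
  have hCs : (C : E →ₗ[ℂ] E).IsSymmetric := adjoint_comp_self_symmetric T
  have hne : ∀ μ : {μ : ℝ≥0 // μ ≠ 0}, (((μ : ℝ≥0) : ℝ) ^ 2 : ℂ) ≠ 0 := fun μ => by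
    simpa using μ.2
  have hfin : ∀ μ : {μ : ℝ≥0 // μ ≠ 0}, FiniteDimensional ℂ
      (eigenspace (C : E →ₗ[ℂ] E) (((μ : ℝ≥0) : ℝ) ^ 2 : ℂ)) := fun μ =>
    finite_dimensional_eigenspace hCc _ (hne μ)
  have hinj : Function.Injective fun μ : {μ : ℝ≥0 // μ ≠ 0} => (((μ : ℝ≥0) : ℝ) ^ 2 : ℂ) := by
    intro μ ν h
    have h1 : ((μ : ℝ≥0) : ℝ) ^ 2 = ((ν : ℝ≥0) : ℝ) ^ 2 := by
      refine Complex.ofReal_injective ?_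
      rw [Complex.ofReal_pow, Complex.ofReal_pow]
      exact h
    exact Subtype.ext (NNReal.eq ((pow_left_inj₀ μ.1.2 ν.1.2 two_ne_zero).1 h1))
  let b : ∀ μ : {μ : ℝ≥0 // μ ≠ 0}, OrthonormalBasis _ ℂ
      (eigenspace (C : E →ₗ[ℂ] E) (((μ : ℝ≥0) : ℝ) ^ 2 : ℂ)) := fun μ =>
    stdOrthonormalBasis ℂ _
  let e : SVDIndex T → E := fun i => (b i.1 i.2 : E)
  have he : Orthonormal ℂ e :=
    (hCs.orthogonalFamily_eigenspaces.comp hinj).orthonormal_sigma_orthonormal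
      fun μ => (b μ).orthonormal
  have hpos : ∀ i : SVDIndex T, 0 < ((i.1 : ℝ≥0) : ℝ) := fun i =>
    NNReal.coe_pos.2 (pos_iff_ne_zero.2 i.1.2)
  have heig : ∀ i : SVDIndex T, adjoint T (T (e i)) = (((i.1 : ℝ≥0) : ℝ) ^ 2 : ℂ) • e i :=
    fun i => mem_eigenspace_iff.1 (b i.1 i.2).2
  refine ⟨e, fun i => ((((i.1 : ℝ≥0) : ℝ) : ℂ)⁻¹) • T (e i), he, ?_, hpos, fun i => ?_,
    fun x hx => ?_⟩
  · classical
    rw [orthonormal_iff_ite]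
    intro i j
    have hi : (((i.1 : ℝ≥0) : ℝ) : ℂ) ≠ 0 := Complex.ofReal_ne_zero.2 (hpos i).ne'
    rw [inner_smul_left, inner_smul_right, ← adjoint_inner_left, heig, inner_smul_left,
      orthonormal_iff_ite.1 he i j]
    split_ifs with hij
    · subst hij
      simp only [map_inv₀, Complex.conj_ofReal, map_pow, mul_one]
      field_simp
    · simp
  · have hi : (((i.1 : ℝ≥0) : ℝ) : ℂ) ≠ 0 := Complex.ofReal_ne_zero.2 (hpos i).ne'
    rw [smul_smul, mul_inv_cancel₀ hi, one_smul]
  · have horth : ∀ μ : {μ : ℝ≥0 // μ ≠ 0}, ∀ y ∈ eigenspace (C : E →ₗ[ℂ] E)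
        (((μ : ℝ≥0) : ℝ) ^ 2 : ℂ), ⟪y, x⟫ = 0 := fun μ y hy => by
      have h1 : _ = y := congr_arg Subtype.val ((b μ).sum_repr ⟨y, hy⟩)
      rw [← h1, Submodule.coe_sum, sum_inner]
      refine Finset.sum_eq_zero fun k _ => ?_
      rw [Submodule.coe_smul, inner_smul_left]
      exact mul_eq_zero_of_right _ (hx ⟨μ, k⟩)
    apply apply_eq_zero_of_adjoint_comp_self
    -- The eigenspaces of the compact symmetric `C` span a dense subspace, so it suffices that `C x`
    -- is orthogonal to all of them.
    have h0 : C x ∈ (⨆ μ, eigenspace (C : E →ₗ[ℂ] E) μ)ᗮ := by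
      rw [← Submodule.iInf_orthogonal, Submodule.mem_iInf]
      intro ν
      rw [Submodule.mem_orthogonal]
      intro y hy
      have hCy : C y = ν • y := mem_eigenspace_iff.1 hy
      have h1 : ⟪y, C x⟫ = conj ν * ⟪y, x⟫ := by
        rw [← inner_smul_left, ← hCy]
        exact (hCs y x).symm
      rw [h1]
      rcases eq_or_ne y 0 with rfl | hy0
      · simp
      have hn : (‖y‖ : ℂ) ≠ 0 := by simpa using hy0
      -- An eigenvalue of `T* T` is the square of `‖T y‖ / ‖y‖`. If non-zero, it is one of the
      -- indexed squares and `y` is orthogonal to `x`; if zero, the factor `conj ν` vanishes.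
      have h2 : ν = (((‖T y‖₊ / ‖y‖₊ : ℝ≥0) : ℝ) : ℂ) ^ 2 := by
        have h3 : ⟪y, C y⟫ = (‖T y‖ : ℂ) ^ 2 := by
          rw [hC, comp_apply, adjoint_inner_right, inner_self_eq_norm_sq_to_K]
          rfl
        rw [hCy, inner_smul_right, inner_self_eq_norm_sq_to_K] at h3
        push_cast
        rw [div_pow, eq_div_iff (pow_ne_zero 2 hn)]
        exact h3
      rcases eq_or_ne (‖T y‖₊ / ‖y‖₊) 0 with h3 | h3
      · rw [h2, h3]
        simp
      · rw [horth ⟨_, h3⟩ y (by rw [← h2]; exact hy), mul_zero]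
    rw [orthogonalComplement_iSup_eigenspaces_eq_bot hCc hCs, Submodule.mem_bot] at h0
    exact h0

end Existence

/-! ### Schatten sums as power sums of singular values -/

section Schatten

variable {H : Type*} [NormedAddCommGroup H] [InnerProductSpace ℂ H] [CompleteSpace H]
  {a : H →L[ℂ] H} {p : ℝ}

/-- Factor `|a|^2 - μ^2 = (|a| + μ)(|a| - μ)`; the first factor is injective because `|a| ≥ 0` and
`μ > 0`. -/
theorem eigenspace_abs (a : H →L[ℂ] H) {μ : ℝ} (hμ : 0 < μ) :
    eigenspace ((CFC.abs a : H →L[ℂ] H) : H →ₗ[ℂ] H) (μ : ℂ) =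
      eigenspace ((adjoint a ∘L a : H →L[ℂ] H) : H →ₗ[ℂ] H) ((μ : ℂ) ^ 2) := by
  set B : H →L[ℂ] H := CFC.abs a with hB
  have hBB : ∀ x, B (B x) = adjoint a (a x) := fun x =>
    congr_arg (fun c : H →L[ℂ] H => c x) (CFC.abs_mul_abs a)
  have hpos : B.IsPositive := (nonneg_iff_isPositive _).1 (CFC.abs_nonneg a)
  ext x
  rw [mem_eigenspace_iff, mem_eigenspace_iff]
  change B x = (μ : ℂ) • x ↔ adjoint a (a x) = (μ : ℂ) ^ 2 • x
  rw [← hBB]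
  refine ⟨fun h => by rw [h, map_smul, h, smul_smul, sq], fun h => ?_⟩
  have h1 : B (B x - (μ : ℂ) • x) = -(μ : ℂ) • (B x - (μ : ℂ) • x) := by
    rw [map_sub, map_smul, h]
    module
  have h2 := hpos.re_inner_nonneg_right (B x - (μ : ℂ) • x)
  rw [h1, inner_smul_right, inner_self_eq_norm_sq_to_K] at h2
  have h3 : 0 ≤ -(μ * ‖B x - (μ : ℂ) • x‖ ^ 2) := by
    convert h2 using 1
    change _ = (-(μ : ℂ) * ((‖B x - (μ : ℂ) • x‖ : ℝ) : ℂ) ^ 2).re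
    rw [← Complex.ofReal_pow, ← Complex.ofReal_neg, ← Complex.ofReal_mul, Complex.ofReal_re,
      neg_mul]
  have h4 : ‖B x - (μ : ℂ) • x‖ ^ 2 ≤ 0 := by
    by_contra h5
    have := mul_pos hμ (not_le.1 h5)
    linarith
  exact sub_eq_zero.1 (norm_eq_zero.1
    (pow_eq_zero_iff two_ne_zero |>.1 (le_antisymm h4 (sq_nonneg _))))

theorem schattenSum_eq_powSum_svdIndex (a : H →L[ℂ] H) (hp : 0 < p) :
    schattenSum p a = powSum p fun i : SVDIndex a => ((i.1 : ℝ≥0) : ℝ) := by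
  have h1 : powSum p (fun i : SVDIndex a => ((i.1 : ℝ≥0) : ℝ)) = _ :=
    ENNReal.tsum_sigma fun (μ : {μ : ℝ≥0 // μ ≠ 0}) _ => ENNReal.ofReal (((μ : ℝ≥0) : ℝ) ^ p)
  rw [h1, schattenSum]
  rw [← tsum_subtype_eq_of_support_subset (s := {μ : ℝ≥0 | μ ≠ 0})]
  · refine tsum_congr fun μ => ?_
    rw [eigenspace_abs a (NNReal.coe_pos.2 (pos_iff_ne_zero.2 μ.2)), tsum_fintype,
      Finset.sum_const, Finset.card_univ, Fintype.card_fin, nsmul_eq_mul]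
    congr 1
    have h2 : ∀ x : ℝ≥0, (x : ℝ≥0∞) ^ p = ENNReal.ofReal ((x : ℝ) ^ p) := fun x => by
      rw [← ENNReal.ofReal_rpow_of_nonneg x.coe_nonneg hp.le, ENNReal.ofReal_coe_nnreal]
    exact h2 μ.1
  · intro μ hμ h0
    apply hμ
    change _ * (μ : ℝ≥0∞) ^ p = 0
    rw [h0, ENNReal.coe_zero, ENNReal.zero_rpow_of_pos hp, mul_zero]

theorem IsSVD.schattenSum_eq {ι : Type*} {s : ι → ℝ} {e f : ι → H} (h : IsSVD a s e f)
    (ha : IsCompactOperator a) (hp : 0 < p) (hp2 : p ≠ 2) : schattenSum p a = powSum p s := by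
  obtain ⟨e', f', h'⟩ := ha.exists_isSVD
  rw [schattenSum_eq_powSum_svdIndex a hp, h'.powSum_eq h hp hp2]

theorem schattenSum_const_smul (ha : IsCompactOperator a) (hp : 0 < p) (hp2 : p ≠ 2) {c : ℂ}
    (hc : c ≠ 0) : schattenSum p (c • a) = ENNReal.ofReal (‖c‖ ^ p) * schattenSum p a := by
  obtain ⟨e, f, h⟩ := ha.exists_isSVD
  rw [(h.const_smul hc).schattenSum_eq (ha.smul c) hp hp2, h.schattenSum_eq ha hp hp2,
    h.powSum_const_mul (norm_nonneg c)]

/-- Since `‖a* z‖^2 = ⟨z, a a* z⟩ ≤ ‖z‖ ‖a a* z‖`, a finite net for the image of the unit ball under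
the compact `a a*` gives one for `a*`. Differences `z` of points of the ball have norm at most `2`,
whence `ε ^ 2 / 4`. -/
theorem isCompactOperator_adjoint (ha : IsCompactOperator a) : IsCompactOperator (adjoint a) := by
  have hc : IsCompactOperator (a ∘L adjoint a) := ha.comp_clm (adjoint a)
  have h1 := ((IsCompactOperator.isCompact_closure_image_closedBall
    (f := ((a ∘L adjoint a : H →L[ℂ] H) : H →ₗ[ℂ] H)) hc 1).totallyBounded).subset subset_closure
  refine (isCompactOperator_iff_isCompact_closure_image_closedBall
    ((adjoint a : H →L[ℂ] H) : H →ₗ[ℂ] H) one_pos).2 ?_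
  refine TotallyBounded.isCompact_of_isClosed (TotallyBounded.closure ?_) isClosed_closure
  rw [Metric.totallyBounded_iff]
  intro ε hε
  obtain ⟨t, htB, htf, ht⟩ := Set.exists_subset_image_finite_and.1
    (Metric.finite_approx_of_totallyBounded h1 (ε ^ 2 / 4) (by positivity))
  refine ⟨_, htf.image (adjoint a), ?_⟩
  rintro _ ⟨x, hx, rfl⟩
  have h2 := ht (Set.mem_image_of_mem _ hx)
  simp only [Set.mem_iUnion, Set.mem_image, exists_prop] at h2 ⊢
  obtain ⟨_, ⟨y, hy, rfl⟩, hxy⟩ := h2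
  refine ⟨_, ⟨y, hy, rfl⟩, ?_⟩
  rw [mem_ball_iff_norm] at hxy ⊢
  change ‖adjoint a x - adjoint a y‖ < ε
  have h3 : ‖a (adjoint a (x - y))‖ < ε ^ 2 / 4 := by
    rw [map_sub, map_sub]
    exact hxy
  have h4 : ‖x - y‖ ≤ 2 := by
    have h5 := norm_sub_le x y
    have h6 := mem_closedBall_zero_iff.1 hx
    have h7 := mem_closedBall_zero_iff.1 (htB hy)
    linarith
  rw [← map_sub]
  refine lt_of_pow_lt_pow_left₀ 2 hε.le ?_
  calc ‖adjoint a (x - y)‖ ^ 2 = ‖⟪x - y, a (adjoint a (x - y))⟫‖ := by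
        rw [← adjoint_inner_left, inner_self_eq_norm_sq_to_K]
        simp
    _ ≤ ‖x - y‖ * ‖a (adjoint a (x - y))‖ := norm_inner_le_norm _ _
    _ ≤ 2 * (ε ^ 2 / 4) := mul_le_mul h4 h3.le (norm_nonneg _) two_pos.le
    _ < ε ^ 2 := by linarith [pow_pos hε 2]

end Schatten

/-! ### The Clarkson-McCarthy inequalities via the column operator -/

theorem two_mul_rpow_le_of_sq_add_sq {p x y m : ℝ} (hp : 2 < p) (hx : 0 ≤ x) (hy : 0 ≤ y)
    (hm : 0 ≤ m) (h : x ^ 2 + y ^ 2 = 2 * m ^ 2) : 2 * m ^ p ≤ x ^ p + y ^ p := by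
  have hr : 1 < p / 2 := by linarith
  have h1 := rpow_tangent_le hr (sq_nonneg x) (sq_nonneg m)
  have h2 := rpow_tangent_le hr (sq_nonneg y) (sq_nonneg m)
  have h3 : ∀ z : ℝ, 0 ≤ z → (z ^ 2) ^ (p / 2) = z ^ p := fun z hz => by
    rw [← Real.rpow_natCast_mul hz]
    push_cast
    ring_nf
  rw [h3 _ hx, h3 _ hm] at h1
  rw [h3 _ hy, h3 _ hm] at h2
  have h4 : p / 2 * (m ^ 2) ^ (p / 2 - 1) * (x ^ 2 - m ^ 2) +
      p / 2 * (m ^ 2) ^ (p / 2 - 1) * (y ^ 2 - m ^ 2) = 0 := by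
    rw [← mul_add, show x ^ 2 - m ^ 2 + (y ^ 2 - m ^ 2) = 0 by linarith, mul_zero]
  linarith

theorem le_two_mul_rpow_of_sq_add_sq {p x y m : ℝ} (hp0 : 0 < p) (hp : p < 2) (hx : 0 ≤ x)
    (hy : 0 ≤ y) (hm : 0 < m) (h : x ^ 2 + y ^ 2 = 2 * m ^ 2) :
    x ^ p + y ^ p ≤ 2 * m ^ p := by
  have hr0 : 0 < p / 2 := by linarith
  have hr : p / 2 < 1 := by linarith
  have h1 := rpow_le_tangent hr0 hr (sq_nonneg x) (pow_pos hm 2)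
  have h2 := rpow_le_tangent hr0 hr (sq_nonneg y) (pow_pos hm 2)
  have h3 : ∀ z : ℝ, 0 ≤ z → (z ^ 2) ^ (p / 2) = z ^ p := fun z hz => by
    rw [← Real.rpow_natCast_mul hz]
    push_cast
    ring_nf
  rw [h3 _ hx, h3 _ hm.le] at h1
  rw [h3 _ hy, h3 _ hm.le] at h2
  have h4 : p / 2 * (m ^ 2) ^ (p / 2 - 1) * (x ^ 2 - m ^ 2) +
      p / 2 * (m ^ 2) ^ (p / 2 - 1) * (y ^ 2 - m ^ 2) = 0 := by
    rw [← mul_add, show x ^ 2 - m ^ 2 + (y ^ 2 - m ^ 2) = 0 by linarith, mul_zero]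
  linarith

theorem powSum_sum {ι κ : Type*} (p : ℝ) (t : ι ⊕ κ → ℝ) :
    powSum p t = powSum p (fun i => t (Sum.inl i)) + powSum p (fun j => t (Sum.inr j)) :=
  ENNReal.summable.tsum_sum ENNReal.summable

section Column

variable {E F G : Type*} [NormedAddCommGroup E] [InnerProductSpace ℂ E]
  [NormedAddCommGroup F] [InnerProductSpace ℂ F]
  [NormedAddCommGroup G] [InnerProductSpace ℂ G]

/-- The operator `x ↦ (a x, b x)` into the Hilbert sum. -/
def columnOperator (a : E →L[ℂ] F) (b : E →L[ℂ] G) : E →L[ℂ] WithLp 2 (F × G) :=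
  ((WithLp.prodContinuousLinearEquiv 2 ℂ F G).symm : F × G →L[ℂ] WithLp 2 (F × G)) ∘L a.prod b

variable {a : E →L[ℂ] F} {b : E →L[ℂ] G}

theorem norm_columnOperator_sq (x : E) :
    ‖columnOperator a b x‖ ^ 2 = ‖a x‖ ^ 2 + ‖b x‖ ^ 2 := by
  rw [WithLp.prod_norm_sq_eq_of_L2]
  rfl

theorem columnOperator_eq_zero {x : E} (h : columnOperator a b x = 0) : a x = 0 ∧ b x = 0 := by
  have h1 := norm_columnOperator_sq (a := a) (b := b) x
  rw [h, norm_zero] at h1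
  constructor <;> rw [← norm_eq_zero] <;> nlinarith [sq_nonneg ‖a x‖, sq_nonneg ‖b x‖]

theorem isCompactOperator_columnOperator (ha : IsCompactOperator a) (hb : IsCompactOperator b) :
    IsCompactOperator (columnOperator a b) := by
  have h1 := (ha.clm_comp (ContinuousLinearMap.inl ℂ F G)).add
    (hb.clm_comp (ContinuousLinearMap.inr ℂ F G))
  have h2 := h1.clm_comp
    ((WithLp.prodContinuousLinearEquiv 2 ℂ F G).symm : F × G →L[ℂ] WithLp 2 (F × G))
  have h3 : ⇑(columnOperator a b) =
      ((WithLp.prodContinuousLinearEquiv 2 ℂ F G).symm : F × G →L[ℂ] WithLp 2 (F × G)) ∘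
        (ContinuousLinearMap.inl ℂ F G ∘ a + ContinuousLinearMap.inr ℂ F G ∘ b) := by
    funext x
    simp [columnOperator]
  rw [h3]
  exact h2

theorem adjoint_columnOperator_apply [CompleteSpace E] [CompleteSpace F] [CompleteSpace G]
    (y : WithLp 2 (F × G)) :
    adjoint (columnOperator a b) y = adjoint a y.fst + adjoint b y.snd := by
  refine ext_inner_right ℂ fun x => ?_
  rw [adjoint_inner_left, inner_add_left, adjoint_inner_left, adjoint_inner_left]
  rfl

variable {ι κ : Type*}

/-- The union of two families, seen in the Hilbert sum. -/
def hilbertSumFamily (f : ι → F) (g : κ → G) : ι ⊕ κ → WithLp 2 (F × G) :=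
  Sum.elim (fun i => WithLp.toLp 2 (f i, 0)) fun j => WithLp.toLp 2 (0, g j)

theorem Orthonormal.hilbertSumFamily {f : ι → F} {g : κ → G} (hf : Orthonormal ℂ f)
    (hg : Orthonormal ℂ g) : Orthonormal ℂ (hilbertSumFamily f g) := by
  classical
  rw [orthonormal_iff_ite] at *
  rintro (i | i) (j | j) <;> simp [_root_.hilbertSumFamily, hf, hg]

variable [CompleteSpace E] [CompleteSpace F] [CompleteSpace G] {τ : Type*}
  {α : ι → ℝ} {e : ι → E} {f : ι → F} {β : κ → ℝ} {e' : κ → E} {g : κ → G}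
  {t : τ → ℝ} {u : τ → E} {v : τ → WithLp 2 (F × G)} {p : ℝ}

theorem adjoint_columnOperator_inl (ha : IsSVD a α e f) (j : ι) :
    adjoint (columnOperator a b) (hilbertSumFamily f g (Sum.inl j)) = (α j : ℂ) • e j := by
  rw [adjoint_columnOperator_apply]
  simp [hilbertSumFamily, ha.adjoint.map]

theorem adjoint_columnOperator_inr (hb : IsSVD b β e' g) (j : κ) :
    adjoint (columnOperator a b) (hilbertSumFamily f g (Sum.inr j)) = (β j : ℂ) • e' j := by
  rw [adjoint_columnOperator_apply]
  simp [hilbertSumFamily, hb.adjoint.map]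

theorem powSum_adjoint_columnOperator (ha : IsSVD a α e f) (hb : IsSVD b β e' g) :
    powSum p (fun k => ‖adjoint (columnOperator a b) (hilbertSumFamily f g k)‖) =
      powSum p α + powSum p β := by
  rw [powSum_sum]
  simp only [adjoint_columnOperator_inl ha, adjoint_columnOperator_inr hb, norm_smul, ha.left.1,
    hb.left.1, mul_one, Complex.norm_real, Real.norm_of_nonneg (ha.pos _).le,
    Real.norm_of_nonneg (hb.pos _).le]

theorem adjoint_columnOperator_ker (ha : IsSVD a α e f) (hb : IsSVD b β e' g)
    (y : WithLp 2 (F × G)) (hy : ∀ k, ⟪hilbertSumFamily f g k, y⟫ = 0) :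
    adjoint (columnOperator a b) y = 0 := by
  rw [adjoint_columnOperator_apply, ha.adjoint.ker _ fun i => ?_, hb.adjoint.ker _ fun i => ?_,
    add_zero]
  · simpa [hilbertSumFamily] using hy (Sum.inr i)
  · simpa [hilbertSumFamily] using hy (Sum.inl i)

/-- The column sends `e j` to a vector of squared norm `α j ^ 2 + ‖b (e j)‖ ^ 2`. Under `h`, `e j`
meets only singular vectors of value `α j`, so that squared norm is at most `α j ^ 2`. -/
theorem apply_eq_zero_of_column_svd (ha : IsSVD a α e f) (hT : IsSVD (columnOperator a b) t u v)
    (h : ∀ i j, ⟪v i, hilbertSumFamily f g (Sum.inl j)⟫ ≠ 0 → t i = α j) (j : ι) :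
    b (e j) = 0 := by
  have h1 : ∀ i, ⟪u i, e j⟫ ≠ 0 → t i = α j := fun i hi => by
    refine h i j fun h0 => hi ?_
    have h2 := hT.adjoint.inner_apply i (hilbertSumFamily f g (Sum.inl j))
    rw [adjoint_columnOperator_inl ha, h0, mul_zero, inner_smul_right] at h2
    exact (mul_eq_zero.1 h2).resolve_left (Complex.ofReal_ne_zero.2 (ha.pos j).ne')
  have h2 := hT.hasSum_norm_sq (e j)
  have h3 : (fun i => ‖⟪u i, e j⟫‖ ^ 2 * t i ^ 2) = fun i => ‖⟪u i, e j⟫‖ ^ 2 * α j ^ 2 := by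
    funext i
    by_cases hi : ⟪u i, e j⟫ = 0
    · simp [hi]
    · rw [h1 i hi]
  rw [h3, norm_columnOperator_sq, ha.norm_map] at h2
  have h4 := h2.unique ((hT.left.inner_products_summable (e j)).hasSum.mul_right (α j ^ 2))
  have h5 := mul_le_mul_of_nonneg_right (hT.left.tsum_norm_inner_sq_le_one (ha.left.1 j))
    (sq_nonneg (α j))
  have h6 : ‖b (e j)‖ ^ 2 ≤ 0 := by linarith
  exact norm_eq_zero.1 (pow_eq_zero_iff two_ne_zero |>.1 (le_antisymm h6 (sq_nonneg _)))

end Column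

section Clarkson

variable {E F : Type*} [NormedAddCommGroup E] [InnerProductSpace ℂ E] [CompleteSpace E]
  [NormedAddCommGroup F] [InnerProductSpace ℂ F] [CompleteSpace F] {a b : E →L[ℂ] F}
  {ι κ τ : Type*} {t : τ → ℝ} {u : τ → E} {v : τ → WithLp 2 (F × F)}
  {s : ι → ℝ} {e : ι → E} {f : ι → F} {s' : κ → ℝ} {e' : κ → E} {f' : κ → F} {p : ℝ}

omit [CompleteSpace E] [CompleteSpace F] in
-- The parallelogram law: `|a + b|^2 + |a - b|^2` is twice `T* T` for the column `T`, which is why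
-- `T` mediates between `a ± b` and the pair `a`, `b`.
theorem sq_norm_add_sub_column_svd (hT : IsSVD (columnOperator a b) t u v) (i : τ) :
    ‖(a + b) (u i)‖ ^ 2 + ‖(a - b) (u i)‖ ^ 2 = 2 * t i ^ 2 := by
  have h1 := norm_columnOperator_sq (a := a) (b := b) (u i)
  rw [hT.norm_map] at h1
  have h2 := parallelogram_law_with_norm ℂ (a (u i)) (b (u i))
  rw [add_apply, sub_apply]
  nlinarith

theorem two_mul_powSum (t : τ → ℝ) :
    2 * powSum p t = ∑' i, ENNReal.ofReal (2 * t i ^ p) := by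
  rw [powSum, ← ENNReal.tsum_mul_left]
  refine tsum_congr fun i => ?_
  rw [ENNReal.ofReal_mul two_pos.le, ENNReal.ofReal_ofNat]

theorem powSum_add_powSum (x y : τ → ℝ) (hx : ∀ i, 0 ≤ x i) (hy : ∀ i, 0 ≤ y i) :
    powSum p x + powSum p y = ∑' i, ENNReal.ofReal (x i ^ p + y i ^ p) := by
  rw [powSum, powSum, ← ENNReal.tsum_add]
  refine tsum_congr fun i => ?_
  rw [ENNReal.ofReal_add (Real.rpow_nonneg (hx i) p) (Real.rpow_nonneg (hy i) p)]

theorem two_mul_powSum_column_le (hp : 2 < p) (hT : IsSVD (columnOperator a b) t u v)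
    (hs : IsSVD (a + b) s e f) (hd : IsSVD (a - b) s' e' f') :
    2 * powSum p t ≤ powSum p s + powSum p s' := by
  refine le_trans ?_ (add_le_add (hs.powSum_norm_le hp hT.left).1 (hd.powSum_norm_le hp hT.left).1)
  rw [two_mul_powSum t,
    powSum_add_powSum _ _ (fun _ => norm_nonneg _) (fun _ => norm_nonneg _)]
  exact ENNReal.tsum_le_tsum fun i => ENNReal.ofReal_le_ofReal
    (two_mul_rpow_le_of_sq_add_sq hp (norm_nonneg _) (norm_nonneg _) (hT.pos i).le
      (sq_norm_add_sub_column_svd hT i))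

theorem le_two_mul_powSum_column (hp0 : 0 < p) (hp : p < 2) (hT : IsSVD (columnOperator a b) t u v)
    (hs : IsSVD (a + b) s e f) (hd : IsSVD (a - b) s' e' f') :
    powSum p s + powSum p s' ≤ 2 * powSum p t := by
  have hker : ∀ x, (∀ j, ⟪u j, x⟫ = 0) → a x = 0 ∧ b x = 0 := fun x hx =>
    columnOperator_eq_zero (hT.ker x hx)
  refine (add_le_add
    (hs.le_powSum_norm hp0 hp hT.left fun x hx => by simp [hker x hx]).1
    (hd.le_powSum_norm hp0 hp hT.left fun x hx => by simp [hker x hx]).1).trans ?_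
  rw [two_mul_powSum t,
    powSum_add_powSum _ _ (fun _ => norm_nonneg _) (fun _ => norm_nonneg _)]
  exact ENNReal.tsum_le_tsum fun i => ENNReal.ofReal_le_ofReal
    (le_two_mul_rpow_of_sq_add_sq hp0 hp (norm_nonneg _) (norm_nonneg _) (hT.pos i)
      (sq_norm_add_sub_column_svd hT i))

end Clarkson

section Schatten

variable {H : Type*} [NormedAddCommGroup H] [InnerProductSpace ℂ H] [CompleteSpace H]
  {a b : H →L[ℂ] H} {p : ℝ}

/-- The equality case of the Clarkson-McCarthy inequalities. -/
theorem comp_adjoint_eq_zero_of_clarkson (ha : IsCompactOperator a) (hb : IsCompactOperator b)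
    (hp : 0 < p) (hp2 : p ≠ 2) (hfin : schattenSum p a + schattenSum p b ≠ ∞)
    (h : schattenSum p (a + b) + schattenSum p (a - b) = 2 * (schattenSum p a + schattenSum p b)) :
    b ∘L adjoint a = 0 := by
  obtain ⟨e₁, f₁, h₁⟩ := ha.exists_isSVD
  obtain ⟨e₂, f₂, h₂⟩ := hb.exists_isSVD
  obtain ⟨e₃, f₃, h₃⟩ := IsCompactOperator.exists_isSVD (T := a + b) (ha.add hb)
  obtain ⟨e₄, f₄, h₄⟩ := IsCompactOperator.exists_isSVD (T := a - b) (ha.sub hb)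
  obtain ⟨u, v, hT⟩ := (isCompactOperator_columnOperator ha hb).exists_isSVD
  rw [h₁.schattenSum_eq ha hp hp2, h₂.schattenSum_eq hb hp hp2] at h hfin
  rw [h₃.schattenSum_eq (ha.add hb) hp hp2, h₄.schattenSum_eq (ha.sub hb) hp hp2] at h
  rw [← powSum_adjoint_columnOperator h₁ h₂] at h hfin
  have hg := h₁.right.hilbertSumFamily h₂.right
  -- The power sum of the column's singular values lies between the two sides of `h`, up to the
  -- factor `2`. So `h` forces equality in the comparison of the column's adjoint with the family
  -- `hilbertSumFamily f₁ f₂`.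
  have key : ∀ i j, ⟪v i, hilbertSumFamily f₁ f₂ j⟫ ≠ 0 → ((i.1 : ℝ≥0) : ℝ) =
      ‖adjoint (columnOperator a b) (hilbertSumFamily f₁ f₂ j)‖ := by
    rcases hp2.lt_or_gt with hp2 | hp2
    · have h5 := hT.adjoint.le_powSum_norm hp hp2 hg (adjoint_columnOperator_ker h₁ h₂)
      have h6 := le_two_mul_powSum_column hp hp2 hT h₃ h₄
      rw [h] at h6
      have h7 := (ENNReal.mul_le_mul_iff_right two_ne_zero ENNReal.ofNat_ne_top).1 h6
      exact h5.2 (h5.1.antisymm h7) (ne_top_of_le_ne_top hfin h5.1)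
    · have h5 := hT.adjoint.powSum_norm_le hp2 hg
      have h6 := two_mul_powSum_column_le hp2 hT h₃ h₄
      rw [h] at h6
      have h7 := (ENNReal.mul_le_mul_iff_right two_ne_zero ENNReal.ofNat_ne_top).1 h6
      exact h5.2 (h5.1.antisymm h7) (ne_top_of_le_ne_top hfin h7)
  have h0 := apply_eq_zero_of_column_svd (g := f₂) h₁ hT fun i j hij => by
    rw [key i _ hij, adjoint_columnOperator_inl h₁, norm_smul, h₁.left.1, mul_one,
      Complex.norm_real, Real.norm_of_nonneg (h₁.pos j).le]
  -- The range of `adjoint a` lies in the closed span of the `e₁ j`, all of which `b` kills.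
  ext y
  have h8 := (h₁.adjoint.hasSum_apply y).mapL b
  simp only [map_smul, h0, smul_zero] at h8
  exact h8.unique hasSum_zero

theorem schattenSum_adjoint (ha : IsCompactOperator a) (hp : 0 < p) (hp2 : p ≠ 2) :
    schattenSum p (adjoint a) = schattenSum p a := by
  obtain ⟨e, f, h⟩ := ha.exists_isSVD
  rw [h.schattenSum_eq ha hp hp2,
    h.adjoint.schattenSum_eq (isCompactOperator_adjoint ha) hp hp2]

theorem adjoint_comp_eq_zero_of_clarkson (ha : IsCompactOperator a) (hb : IsCompactOperator b)
    (hp : 0 < p) (hp2 : p ≠ 2) (hfin : schattenSum p a + schattenSum p b ≠ ∞)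
    (h : schattenSum p (a + b) + schattenSum p (a - b) = 2 * (schattenSum p a + schattenSum p b)) :
    adjoint b ∘L a = 0 := by
  have h1 := comp_adjoint_eq_zero_of_clarkson (isCompactOperator_adjoint ha)
    (isCompactOperator_adjoint hb) hp hp2
  rw [← map_add, ← map_sub, schattenSum_adjoint ha hp hp2, schattenSum_adjoint hb hp hp2,
    schattenSum_adjoint (ha.add hb) hp hp2, schattenSum_adjoint (ha.sub hb) hp hp2,
    adjoint_adjoint] at h1
  exact h1 hfin h

end Schatten

/-! ### Strict convexity at distance two -/

theorem four_mul_rpow_le {p c : ℝ} (hp : 1 < p) (hc : 0 ≤ c) {x y z w : ℝ} (hx : 0 ≤ x)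
    (hy : 0 ≤ y) (hz : 0 ≤ z) (hw : 0 ≤ w) (h : 4 * c ≤ x + y + z + w) :
    4 * c ^ p ≤ x ^ p + y ^ p + z ^ p + w ^ p ∧
    (4 * c ^ p = x ^ p + y ^ p + z ^ p + w ^ p → x = c ∧ y = c ∧ z = c ∧ w = c) := by
  have h1 := rpow_tangent_le hp hx hc
  have h2 := rpow_tangent_le hp hy hc
  have h3 := rpow_tangent_le hp hz hc
  have h4 := rpow_tangent_le hp hw hc
  set d := p * c ^ (p - 1) with hd
  have hd0 : 0 ≤ d := mul_nonneg (by linarith) (Real.rpow_nonneg hc _)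
  have h5 : 0 ≤ d * (x - c) + d * (y - c) + d * (z - c) + d * (w - c) := by
    have := mul_nonneg hd0 (sub_nonneg.2 h)
    linarith
  refine ⟨by linarith, fun heq => ⟨?_, ?_, ?_, ?_⟩⟩ <;> by_contra hne
  · linarith [rpow_tangent_lt hp hx hc hne]
  · linarith [rpow_tangent_lt hp hy hc hne]
  · linarith [rpow_tangent_lt hp hz hc hne]
  · linarith [rpow_tangent_lt hp hw hc hne]

theorem ENNReal.eq_one_of_four_le {x y z w : ℝ≥0∞} (hx : x ≤ 1) (hy : y ≤ 1) (hz : z ≤ 1)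
    (hw : w ≤ 1) (h : 4 ≤ x + y + z + w) : x = 1 ∧ y = 1 ∧ z = 1 ∧ w = 1 := by
  lift x to ℝ≥0 using ne_top_of_le_ne_top one_ne_top hx
  lift y to ℝ≥0 using ne_top_of_le_ne_top one_ne_top hy
  lift z to ℝ≥0 using ne_top_of_le_ne_top one_ne_top hz
  lift w to ℝ≥0 using ne_top_of_le_ne_top one_ne_top hw
  norm_cast at *
  have hx' : (x : ℝ) ≤ 1 := by exact_mod_cast hx
  have hy' : (y : ℝ) ≤ 1 := by exact_mod_cast hy
  have hz' : (z : ℝ) ≤ 1 := by exact_mod_cast hz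
  have hw' : (w : ℝ) ≤ 1 := by exact_mod_cast hw
  have h' : (4 : ℝ) ≤ x + y + z + w := by exact_mod_cast h
  refine ⟨?_, ?_, ?_, ?_⟩ <;> apply NNReal.eq <;> push_cast <;> linarith

theorem Orthonormal.inner_eq_zero_of_tsum_eq {E κ : Type*} [NormedAddCommGroup E]
    [InnerProductSpace ℂ E] [CompleteSpace E] {e : κ → E} (he : Orthonormal ℂ e) {x y : E}
    (hy : ∑' j, ‖⟪e j, y⟫‖ ^ 2 = ‖y‖ ^ 2) (hx : ∀ j, ⟪e j, x⟫ = 0) : ⟪y, x⟫ = 0 := by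
  obtain ⟨z, hz, hz'⟩ := he.exists_hasSum_inner_smul y
  have h1 : ∀ x, (∀ j, ⟪e j, x⟫ = 0) → ⟪z, x⟫ = 0 := fun x hx => by
    have h2 := hz.mapL (innerSL ℂ x)
    simp only [innerSL_apply_apply, inner_smul_right, inner_eq_zero_symm.1 (hx _), mul_zero] at h2
    exact inner_eq_zero_symm.1 (h2.unique hasSum_zero)
  have h2 := (he.hasSum_norm_inner_sq h1).tsum_eq
  have h3 : ∀ j, ⟪e j, z⟫ = ⟪e j, y⟫ := fun j => by
    have h4 := hz' j
    rw [inner_sub_right, sub_eq_zero] at h4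
    exact h4.symm
  simp only [h3, hy] at h2
  have h5 := norm_add_sq_eq_norm_sq_add_norm_sq_of_inner_eq_zero z (y - z) (h1 _ hz')
  rw [add_sub_cancel] at h5
  have h6 : ‖y - z‖ = 0 := by nlinarith [norm_nonneg (y - z)]
  rw [sub_eq_zero.1 (norm_eq_zero.1 h6)]
  exact h1 x hx

namespace IsSVD

variable {E F ι κ : Type*} [NormedAddCommGroup E] [InnerProductSpace ℂ E] [CompleteSpace E]
  [NormedAddCommGroup F] [InnerProductSpace ℂ F] [CompleteSpace F] {T : E →L[ℂ] F} {s : ι → ℝ}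
  {e : ι → E} {f : ι → F} {p : ℝ}

omit [CompleteSpace F] in
-- Termwise `2xy ≤ x^2 + y^2`; the two sums are `⟨x, |T| x⟩` and `⟨y, |T*| y⟩`.
theorem norm_inner_le (h : IsSVD T s e f) (x : E) (y : F) :
    ‖⟪y, T x⟫‖ ≤ ((∑' i, ‖⟪e i, x⟫‖ ^ 2 * s i) + ∑' i, ‖⟪f i, y⟫‖ ^ 2 * s i) / 2 := by
  have hx := (summable_mul_of_le (fun i => sq_nonneg _) (fun i => (h.pos i).le) h.le_norm
    (h.left.inner_products_summable x)).hasSum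
  have hy := (summable_mul_of_le (fun i => sq_nonneg _) (fun i => (h.pos i).le) h.le_norm
    (h.right.inner_products_summable y)).hasSum
  refine ((h.hasSum_apply x).mapL (innerSL ℂ y)).norm_le_of_bounded ((hx.add hy).div_const 2)
    fun i => ?_
  rw [innerSL_apply_apply, inner_smul_right, norm_mul, norm_mul, Complex.norm_real,
    Real.norm_of_nonneg (h.pos i).le, norm_inner_symm y]
  nlinarith [mul_nonneg (h.pos i).le (sq_nonneg (‖⟪e i, x⟫‖ - ‖⟪f i, y⟫‖))]

/-- Equality in Jensen gives `s i = c j` whenever `e i` and `g j` are not orthogonal, so `‖T (g j)‖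
≤ c j`, and `hre` becomes equality in Cauchy-Schwarz. The rows sum to one, so every `e i` lies in
the closed span of `g`. -/
theorem map_eq_of_powSum_eq (h : IsSVD T s e f) (hp : 1 < p) {g : κ → E} {g' : κ → F}
    (hg : Orthonormal ℂ g) (hg' : ∀ j, ‖g' j‖ = 1) {c : κ → ℝ}
    (hc : ∀ j, ∑' i, ‖⟪e i, g j⟫‖ ^ 2 * s i = c j)
    (hsum : powSum p (fun j => ∑' i, ‖⟪e i, g j⟫‖ ^ 2 * s i) = powSum p s)
    (hfin : powSum p s ≠ ∞) (hre : ∀ j, (⟪g' j, T (g j)⟫).re = c j) :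
    (∀ j, T (g j) = (c j : ℂ) • g' j) ∧ ∀ x, (∀ j, ⟪g j, x⟫ = 0) → T x = 0 := by
  have h1 := (h.left.powSum_inner_le hg hp (fun i => (h.pos i).le) h.le_norm).2 hsum hfin
  refine ⟨fun j => ?_, fun x hx => h.ker x fun i => ?_⟩
  · have h2 := h.hasSum_norm_sq (g j)
    have h3 : (fun i => ‖⟪e i, g j⟫‖ ^ 2 * s i ^ 2) = fun i => ‖⟪e i, g j⟫‖ ^ 2 * c j ^ 2 := by
      funext i
      by_cases hi : ⟪e i, g j⟫ = 0
      · simp [hi]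
      · rw [h1.1 i j hi, hc]
    rw [h3] at h2
    have h4 := h2.unique ((h.left.inner_products_summable (g j)).hasSum.mul_right (c j ^ 2))
    have h5 := mul_le_mul_of_nonneg_right (h.left.tsum_norm_inner_sq_le_one (hg.1 j))
      (sq_nonneg (c j))
    have h6 := norm_sub_sq (𝕜 := ℂ) (T (g j)) ((c j : ℂ) • g' j)
    have h7 : RCLike.re ⟪T (g j), (c j : ℂ) • g' j⟫ = c j * c j := by
      rw [inner_smul_right, ← inner_conj_symm]
      change ((c j : ℂ) * conj ⟪g' j, T (g j)⟫).re = _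
      rw [Complex.re_ofReal_mul, Complex.conj_re, hre]
    rw [h7, norm_smul, hg' j, mul_one, Complex.norm_real, Real.norm_eq_abs, sq_abs] at h6
    have h8 : ‖T (g j) - (c j : ℂ) • g' j‖ ^ 2 ≤ 0 := by nlinarith
    exact sub_eq_zero.1 (norm_eq_zero.1
      (pow_eq_zero_iff two_ne_zero |>.1 (le_antisymm h8 (sq_nonneg _))))
  · refine hg.inner_eq_zero_of_tsum_eq ?_ hx
    have h2 := h1.2 i (h.pos i)
    simpa only [norm_inner_symm (e i), h.left.1 i, one_pow] using h2

end IsSVD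

section StrictConvexity

variable {H : Type*} [NormedAddCommGroup H] [InnerProductSpace ℂ H] [CompleteSpace H]
  {a b : H →L[ℂ] H} {p : ℝ}

/-- Strict convexity of the Schatten norms, for points of the unit sphere at distance `2`. -/
theorem eq_neg_of_schattenSum_sub (hp : 1 < p) (hp2 : p ≠ 2) (ha : IsCompactOperator a)
    (hb : IsCompactOperator b) (ha1 : schattenSum p a = 1) (hb1 : schattenSum p b = 1)
    (hab : schattenSum p (a - b) = ENNReal.ofReal (2 ^ p)) : b = -a := by
  have hp0 : 0 < p := by linarith
  obtain ⟨u, v, h₁⟩ := ha.exists_isSVD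
  obtain ⟨u', v', h₂⟩ := hb.exists_isSVD
  obtain ⟨e, f, h₃⟩ := IsCompactOperator.exists_isSVD (T := a - b) (ha.sub hb)
  rw [h₁.schattenSum_eq ha hp0 hp2] at ha1
  rw [h₂.schattenSum_eq hb hp0 hp2] at hb1
  rw [h₃.schattenSum_eq (ha.sub hb) hp0 hp2] at hab
  generalize (fun i : SVDIndex a => ((i.1 : ℝ≥0) : ℝ)) = t at h₁ ha1
  generalize (fun i : SVDIndex b => ((i.1 : ℝ≥0) : ℝ)) = t' at h₂ hb1
  generalize (fun i : SVDIndex (a - b) => ((i.1 : ℝ≥0) : ℝ)) = s at h₃ hab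
  have hA0 : ∀ j, 0 ≤ ∑' i, ‖⟪u i, e j⟫‖ ^ 2 * t i := fun j =>
    tsum_nonneg fun i => mul_nonneg (sq_nonneg _) (h₁.pos i).le
  have hA0' : ∀ j, 0 ≤ ∑' i, ‖⟪v i, f j⟫‖ ^ 2 * t i := fun j =>
    tsum_nonneg fun i => mul_nonneg (sq_nonneg _) (h₁.pos i).le
  have hB0 : ∀ j, 0 ≤ ∑' i, ‖⟪u' i, e j⟫‖ ^ 2 * t' i := fun j =>
    tsum_nonneg fun i => mul_nonneg (sq_nonneg _) (h₂.pos i).le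
  have hB0' : ∀ j, 0 ≤ ∑' i, ‖⟪v' i, f j⟫‖ ^ 2 * t' i := fun j =>
    tsum_nonneg fun i => mul_nonneg (sq_nonneg _) (h₂.pos i).le
  have hA1 := (h₁.left.powSum_inner_le h₃.left hp (fun i => (h₁.pos i).le) h₁.le_norm).1
  have hA1' := (h₁.right.powSum_inner_le h₃.right hp (fun i => (h₁.pos i).le) h₁.le_norm).1
  have hB1 := (h₂.left.powSum_inner_le h₃.left hp (fun i => (h₂.pos i).le) h₂.le_norm).1
  have hB1' := (h₂.right.powSum_inner_le h₃.right hp (fun i => (h₂.pos i).le) h₂.le_norm).1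
  have hAn := fun j => h₁.norm_inner_le (e j) (f j)
  have hBn := fun j => h₂.norm_inner_le (e j) (f j)
  rw [ha1] at hA1 hA1'
  rw [hb1] at hB1 hB1'
  set A := fun j => ∑' i, ‖⟪u i, e j⟫‖ ^ 2 * t i with hA
  set A' := fun j => ∑' i, ‖⟪v i, f j⟫‖ ^ 2 * t i with hA'
  set B := fun j => ∑' i, ‖⟪u' i, e j⟫‖ ^ 2 * t' i with hB
  set B' := fun j => ∑' i, ‖⟪v' i, f j⟫‖ ^ 2 * t' i with hB'
  have hre : ∀ j, (⟪f j, a (e j)⟫).re - (⟪f j, b (e j)⟫).re = s j := fun j => by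
    rw [← Complex.sub_re, ← inner_sub_right, ← sub_apply, h₃.map, inner_smul_right,
      inner_self_eq_norm_sq_to_K, h₃.right.1 j]
    simp
  have hrea : ∀ j, (⟪f j, a (e j)⟫).re ≤ (A j + A' j) / 2 := fun j =>
    (Complex.re_le_norm _).trans (hAn j)
  have hreb : ∀ j, -(⟪f j, b (e j)⟫).re ≤ (B j + B' j) / 2 := fun j =>
    ((neg_le_abs _).trans (Complex.abs_re_le_norm _)).trans (hBn j)
  -- By `hre`, `hrea` and `hreb` the four averages add up to at least `2 * s j = 4 * (s j / 2)`, so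
  -- convexity compares them with `s j / 2`. Summed over `j`, both sides turn out to be `4`.
  have hJ := fun j => four_mul_rpow_le hp (c := s j / 2) (by linarith [h₃.pos j]) (hA0 j) (hA0' j)
    (hB0 j) (hB0' j) (by linarith [hre j, hrea j, hreb j])
  have hsum : ∑' j, ENNReal.ofReal (4 * (s j / 2) ^ p) = 4 := by
    have h1 : ∀ j, 4 * (s j / 2) ^ p = 4 / 2 ^ p * s j ^ p := fun j => by
      rw [Real.div_rpow (h₃.pos j).le two_pos.le]
      ring
    have h2 : (0 : ℝ) < 2 ^ p := Real.rpow_pos_of_pos two_pos p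
    simp_rw [h1, ENNReal.ofReal_mul (div_pos four_pos h2).le]
    rw [ENNReal.tsum_mul_left]
    change _ * powSum p s = _
    rw [hab, ← ENNReal.ofReal_mul (div_pos four_pos h2).le, div_mul_cancel₀ _ h2.ne']
    simp
  have hsum' : ∑' j, ENNReal.ofReal (A j ^ p + A' j ^ p + B j ^ p + B' j ^ p) =
      powSum p A + powSum p A' + powSum p B + powSum p B' := by
    simp only [powSum]
    rw [← ENNReal.tsum_add, ← ENNReal.tsum_add, ← ENNReal.tsum_add]
    refine tsum_congr fun j => ?_
    have := Real.rpow_nonneg (hA0 j) p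
    have := Real.rpow_nonneg (hA0' j) p
    have := Real.rpow_nonneg (hB0 j) p
    have := Real.rpow_nonneg (hB0' j) p
    rw [ENNReal.ofReal_add (by positivity) (by positivity),
      ENNReal.ofReal_add (by positivity) (by positivity),
      ENNReal.ofReal_add (by positivity) (by positivity)]
  have hle := fun j => ENNReal.ofReal_le_ofReal (hJ j).1
  have h4 : 4 ≤ powSum p A + powSum p A' + powSum p B + powSum p B' := by
    rw [← hsum, ← hsum']
    exact ENNReal.tsum_le_tsum hle
  obtain ⟨hA2, hA2', hB2, hB2'⟩ := ENNReal.eq_one_of_four_le hA1 hA1' hB1 hB1' h4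
  have heq : ∀ j, A j = s j / 2 ∧ A' j = s j / 2 ∧ B j = s j / 2 ∧ B' j = s j / 2 := fun j => by
    have h5 := ENNReal.eq_of_tsum_eq hle
      (by rw [hsum, hsum', hA2, hA2', hB2, hB2']; norm_num) (by rw [hsum]; norm_num) j
    have := Real.rpow_nonneg (hA0 j) p
    have := Real.rpow_nonneg (hA0' j) p
    have := Real.rpow_nonneg (hB0 j) p
    have := Real.rpow_nonneg (hB0' j) p
    have := Real.rpow_nonneg (half_pos (h₃.pos j)).le p
    rw [ENNReal.ofReal_eq_ofReal_iff (by positivity) (by positivity)] at h5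
    exact (hJ j).2 h5
  -- With all four averages equal to `s j / 2`, `a` sends `e j` to `(s j / 2) f j` and `b` to the
  -- opposite vector.
  have hTa := h₁.map_eq_of_powSum_eq hp h₃.left h₃.right.1 (fun j => (heq j).1)
    (hA2.trans ha1.symm) (by rw [ha1]; exact ENNReal.one_ne_top) fun j => by
      obtain ⟨e1, e2, e3, e4⟩ := heq j
      linarith [hre j, hrea j, hreb j]
  have hTb := h₂.map_eq_of_powSum_eq hp h₃.left (g' := fun j => -f j)
    (fun j => by rw [norm_neg, h₃.right.1]) (fun j => (heq j).2.2.1)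
    (hB2.trans hb1.symm) (by rw [hb1]; exact ENNReal.one_ne_top) fun j => by
      obtain ⟨e1, e2, e3, e4⟩ := heq j
      rw [inner_neg_left, Complex.neg_re]
      linarith [hre j, hrea j, hreb j]
  have hsum0 : ∀ j, (a + b) (e j) = 0 := fun j => by
    rw [add_apply, hTa.1, hTb.1, smul_neg, add_neg_cancel]
  rw [eq_neg_iff_add_eq_zero, add_comm]
  ext x
  obtain ⟨z, hz, hz'⟩ := h₃.left.exists_hasSum_inner_smul x
  have h5 : (a + b) z = 0 := by
    have h6 := hz.mapL (a + b)
    simp only [map_smul, hsum0, smul_zero] at h6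
    exact h6.unique hasSum_zero
  have h7 : (a + b) (x - z) = 0 := by
    rw [add_apply, hTa.2 _ hz', hTb.2 _ hz', add_zero]
  rw [map_sub, h5, sub_zero] at h7
  exact h7

end StrictConvexity

/-! ### Orthogonal operators and rank-one operators -/

section Orthogonal

variable {H : Type*} [NormedAddCommGroup H] [InnerProductSpace ℂ H] [CompleteSpace H]
  {a b : H →L[ℂ] H} {p : ℝ}

/-- The two relations make the right, respectively left, singular vectors of `a` and `b` mutually
orthogonal, so the decompositions can be concatenated. -/
theorem isSVD_add_of_orthogonal {ι κ : Type*} {s : ι → ℝ} {e f : ι → H} {s' : κ → ℝ}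
    {e' f' : κ → H} (ha : IsSVD a s e f) (hb : IsSVD b s' e' f') (h1 : b ∘L adjoint a = 0)
    (h2 : adjoint b ∘L a = 0) :
    IsSVD (a + b) (Sum.elim s s') (Sum.elim e e') (Sum.elim f f') := by
  have hpos : ∀ i, (s i : ℂ) ≠ 0 := fun i => Complex.ofReal_ne_zero.2 (ha.pos i).ne'
  have hbe : ∀ i, b (e i) = 0 := fun i => by
    have h3 : b (adjoint a (f i)) = 0 := congr_arg (fun c : H →L[ℂ] H => c (f i)) h1
    rw [ha.adjoint.map, map_smul] at h3
    exact (smul_eq_zero.1 h3).resolve_left (hpos i)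
  have hbf : ∀ i, adjoint b (f i) = 0 := fun i => by
    have h3 : adjoint b (a (e i)) = 0 := congr_arg (fun c : H →L[ℂ] H => c (e i)) h2
    rw [ha.map, map_smul] at h3
    exact (smul_eq_zero.1 h3).resolve_left (hpos i)
  have he : ∀ i j, ⟪e' j, e i⟫ = 0 := fun i j => hb.inner_eq_zero_of_apply_eq_zero (hbe i) j
  have hf : ∀ i j, ⟪f' j, f i⟫ = 0 := fun i j =>
    hb.adjoint.inner_eq_zero_of_apply_eq_zero (hbf i) j
  have hae : ∀ j, a (e' j) = 0 := fun j => ha.ker _ fun i => inner_eq_zero_symm.1 (he i j)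
  have horth : ∀ {e : ι → H} {e' : κ → H}, Orthonormal ℂ e → Orthonormal ℂ e' →
      (∀ i j, ⟪e' j, e i⟫ = 0) → Orthonormal ℂ (Sum.elim e e') := by
    classical
    intro e e' he he' h
    have h' : ∀ i j, ⟪e i, e' j⟫ = 0 := fun i j => inner_eq_zero_symm.1 (h i j)
    rw [orthonormal_iff_ite] at *
    rintro (i | i) (j | j) <;> simp [he, he', h, h']
  refine ⟨horth ha.left hb.left he, horth ha.right hb.right hf, ?_, ?_, fun x hx => ?_⟩
  · rintro (i | i)
    exacts [ha.pos i, hb.pos i]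
  · rintro (i | i)
    · simp [ha.map, hbe]
    · simp [hb.map, hae]
  · rw [add_apply, ha.ker x fun i => hx (Sum.inl i), hb.ker x fun i => hx (Sum.inr i), add_zero]

theorem schattenSum_add_of_orthogonal (ha : IsCompactOperator a) (hb : IsCompactOperator b)
    (hp : 0 < p) (hp2 : p ≠ 2) (h1 : b ∘L adjoint a = 0) (h2 : adjoint b ∘L a = 0) :
    schattenSum p (a + b) = schattenSum p a + schattenSum p b := by
  obtain ⟨e, f, h⟩ := ha.exists_isSVD
  obtain ⟨e', f', h'⟩ := hb.exists_isSVD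
  rw [h.schattenSum_eq ha hp hp2, h'.schattenSum_eq hb hp hp2,
    (isSVD_add_of_orthogonal h h' h1 h2).schattenSum_eq (ha.add hb) hp hp2, powSum_sum]
  rfl

theorem schattenSum_zero (hp : 0 < p) (hp2 : p ≠ 2) : schattenSum p (0 : H →L[ℂ] H) = 0 := by
  have h : IsSVD (0 : H →L[ℂ] H) (fun i : Empty => i.elim) (fun i => i.elim) fun i => i.elim :=
    ⟨⟨fun i => i.elim, fun i => i.elim⟩, ⟨fun i => i.elim, fun i => i.elim⟩, fun i => i.elim,
      fun i => i.elim, fun _ _ => rfl⟩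
  rw [h.schattenSum_eq isCompactOperator_zero hp hp2, powSum, tsum_empty]

theorem schattenSum_smul (ha : IsCompactOperator a) (hp : 0 < p) (hp2 : p ≠ 2) (c : ℂ) :
    schattenSum p (c • a) = ENNReal.ofReal (‖c‖ ^ p) * schattenSum p a := by
  rcases eq_or_ne c 0 with rfl | hc
  · rw [zero_smul, schattenSum_zero hp hp2, norm_zero, Real.zero_rpow hp.ne', ENNReal.ofReal_zero,
      zero_mul]
  · exact schattenSum_const_smul ha hp hp2 hc

theorem schattenSum_smul_of_norm_eq_one (ha : IsCompactOperator a) (hp : 0 < p) (hp2 : p ≠ 2)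
    {c : ℂ} (hc : ‖c‖ = 1) : schattenSum p (c • a) = schattenSum p a := by
  rw [schattenSum_smul ha hp hp2, hc, Real.one_rpow, ENNReal.ofReal_one, one_mul]

omit [CompleteSpace H] in
theorem isCompactOperator_rankOne (x y : H) : IsCompactOperator (rankOne ℂ x y) := by
  have h1 : IsCompactOperator (toSpanSingleton ℂ x) :=
    isCompactOperator_of_locallyCompactSpace_rng _
  rw [rankOne_def']
  exact h1.comp_clm (innerSL ℂ y)

theorem schattenSum_rankOne (hp : 0 < p) (hp2 : p ≠ 2) (x y : H) :
    schattenSum p (rankOne ℂ x y) = ENNReal.ofReal ((‖x‖ * ‖y‖) ^ p) := by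
  by_cases hxy : x = 0 ∨ y = 0
  · rw [rankOne_eq_zero.2 hxy, schattenSum_zero hp hp2]
    have : ‖x‖ * ‖y‖ = 0 := by simpa using hxy
    rw [this, Real.zero_rpow hp.ne', ENNReal.ofReal_zero]
  obtain ⟨hx, hy⟩ := not_or.1 hxy
  have hx' : (‖x‖ : ℂ) ≠ 0 := by simpa using hx
  have hy' : (‖y‖ : ℂ) ≠ 0 := by simpa using hy
  have hunit : ∀ z : H, z ≠ 0 → ‖((‖z‖ : ℂ)⁻¹ • z)‖ = 1 := fun z hz => by
    rw [norm_smul, norm_inv, Complex.norm_real, norm_norm, inv_mul_cancel₀ (norm_ne_zero_iff.2 hz)]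
  have h : IsSVD (rankOne ℂ x y) (fun _ : Unit => ‖x‖ * ‖y‖) (fun _ => (‖y‖ : ℂ)⁻¹ • y)
      (fun _ => (‖x‖ : ℂ)⁻¹ • x) := by
    refine ⟨⟨fun _ => hunit y hy, fun i j hij => (hij rfl).elim⟩,
      ⟨fun _ => hunit x hx, fun i j hij => (hij rfl).elim⟩, fun _ => by positivity, fun _ => ?_,
      fun z hz => ?_⟩
    · rw [rankOne_apply, inner_smul_right, inner_self_eq_norm_sq_to_K, smul_smul]
      congr 1
      push_cast
      field_simp
      rfl
    · have h1 := hz ()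
      rw [inner_smul_left] at h1
      have h2 : conj (‖y‖ : ℂ)⁻¹ ≠ 0 := by simpa using hy
      rw [rankOne_apply, (mul_eq_zero.1 h1).resolve_left h2, zero_smul]
  rw [h.schattenSum_eq (isCompactOperator_rankOne x y) hp hp2, powSum, tsum_fintype]
  simp

theorem mem_schattenSphere_iff (hp : 0 < p) :
    a ∈ schattenSphere H p ↔ IsCompactOperator a ∧ schattenSum p a = 1 := by
  have h : schattenENorm p a = 1 ↔ schattenSum p a = 1 := by
    have h1 := (ENNReal.rpow_left_injective (one_div_pos.2 hp).ne').eq_iff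
      (a := schattenSum p a) (b := 1)
    rwa [ENNReal.one_rpow] at h1
  constructor
  · rintro ⟨⟨h1, -⟩, h2⟩
    exact ⟨h1, h.1 h2⟩
  · rintro ⟨h1, h2⟩
    have h3 := h.2 h2
    exact ⟨⟨h1, by rw [h3]; exact ENNReal.one_lt_top⟩, h3⟩

/-- A sufficient condition, in terms of orthogonal rank-one operators, for being a multiple of a
rank-one operator. -/
theorem eq_smul_rankOne {e f : H} (he : ‖e‖ = 1) (hf : ‖f‖ = 1)
    (h : ∀ e' f' : H, ‖e'‖ = 1 → ‖f'‖ = 1 → ⟪e, e'⟫ = 0 → ⟪f, f'⟫ = 0 →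
      a e' = 0 ∧ adjoint a f' = 0) : ∃ c : ℂ, a = c • rankOne ℂ f e := by
  have hunit : ∀ z : H, z ≠ 0 → ‖((‖z‖ : ℂ)⁻¹ • z)‖ = 1 := fun z hz => by
    rw [norm_smul, norm_inv, Complex.norm_real, norm_norm, inv_mul_cancel₀ (norm_ne_zero_iff.2 hz)]
  have hproj : ∀ e : H, ‖e‖ = 1 → ∀ x, ⟪e, x - ⟪e, x⟫ • e⟫ = 0 := fun e he x => by
    rw [inner_sub_right, inner_smul_right, inner_self_eq_norm_sq_to_K, he]
    simp
  -- The hypothesis `h` speaks of pairs `e'`, `f'` only. A non-zero vector orthogonal to `e` shows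
  -- that the dimension exceeds one, so a partner orthogonal to `f` exists.
  have hex : ∀ e f x : H, ‖e‖ = 1 → ‖f‖ = 1 → x ≠ 0 → ⟪e, x⟫ = 0 →
      ∃ f' : H, ‖f'‖ = 1 ∧ ⟪f, f'⟫ = 0 := by
    intro e f x he hf hx hex
    by_contra! hno
    have hall : ∀ z : H, z = ⟪f, z⟫ • f := fun z => by
      by_contra hz
      have hz' := sub_ne_zero.2 hz
      refine hno _ (hunit _ hz') ?_
      rw [inner_smul_right, hproj f hf, mul_zero]
    rw [hall e, inner_smul_left] at hex
    rcases mul_eq_zero.1 hex with h1 | h1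
    · have h2 := hall e
      rw [(map_eq_zero _).1 h1, zero_smul] at h2
      simp [h2] at he
    · have h2 := hall x
      rw [h1, zero_smul] at h2
      exact hx h2
  have hker : ∀ x, ⟪e, x⟫ = 0 → a x = 0 := fun x hx => by
    rcases eq_or_ne x 0 with rfl | hx0
    · exact map_zero a
    obtain ⟨f', hf', hff'⟩ := hex e f x he hf hx0 hx
    have h1 := (h _ f' (hunit x hx0) hf' (by rw [inner_smul_right, hx, mul_zero]) hff').1
    rw [map_smul] at h1
    exact (smul_eq_zero.1 h1).resolve_left (by simpa using hx0)
  have hker' : ∀ x, ⟪f, x⟫ = 0 → adjoint a x = 0 := fun x hx => by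
    rcases eq_or_ne x 0 with rfl | hx0
    · exact map_zero _
    obtain ⟨e', he', hee'⟩ := hex f e x hf he hx0 hx
    have h1 := (h e' _ he' (hunit x hx0) hee' (by rw [inner_smul_right, hx, mul_zero])).2
    rw [map_smul] at h1
    exact (smul_eq_zero.1 h1).resolve_left (by simpa using hx0)
  refine ⟨⟪f, a e⟫, ?_⟩
  have h1 : a e = ⟪f, a e⟫ • f := by
    rw [← sub_eq_zero, ← inner_self_eq_zero (𝕜 := ℂ)]
    nth_rewrite 2 [sub_eq_add_neg]
    rw [inner_add_right, ← adjoint_inner_left, hker' _ (hproj f hf _), inner_zero_left,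
      inner_neg_right, inner_smul_right, inner_eq_zero_symm.1 (hproj f hf _), mul_zero, neg_zero,
      add_zero]
  ext x
  have h2 := hker _ (hproj e he x)
  rw [map_sub, sub_eq_zero, map_smul] at h2
  rw [h2, smul_apply, rankOne_apply, smul_smul, mul_comm, ← smul_smul, ← h1]

theorem exists_eq_rankOne_of_mem_minimalPartialIsometries
    (ha : a ∈ minimalPartialIsometries H) :
    ∃ e f : H, ‖e‖ = 1 ∧ ‖f‖ = 1 ∧ a = rankOne ℂ f e := by
  obtain ⟨h1, h2⟩ := ha
  obtain ⟨⟨g, hg⟩, hg0, hg1⟩ := finrank_eq_one_iff'.1 h2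
  have hg0' : g ≠ 0 := fun h => hg0 (Subtype.ext h)
  have hn : (‖g‖ : ℂ) ≠ 0 := by simpa using hg0'
  set f : H := (‖g‖ : ℂ)⁻¹ • g with hf
  have hf1 : ‖f‖ = 1 := by
    rw [hf, norm_smul, norm_inv, Complex.norm_real, norm_norm,
      inv_mul_cancel₀ (norm_ne_zero_iff.2 hg0')]
  have h3 : ∀ x, a x = ⟪f, a x⟫ • f := fun x => by
    obtain ⟨c, hc⟩ := hg1 ⟨a x, x, rfl⟩
    have hc' : c • g = a x := congr_arg Subtype.val hc
    have hgf : g = (‖g‖ : ℂ) • f := by rw [hf, smul_smul, mul_inv_cancel₀ hn, one_smul]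
    rw [← hc', hgf, smul_smul, inner_smul_right, inner_self_eq_norm_sq_to_K, hf1]
    simp
  set e : H := adjoint a f with he
  have h4 : a = rankOne ℂ f e := by
    ext x
    rw [rankOne_apply, he, adjoint_inner_left]
    exact h3 x
  refine ⟨e, f, ?_, hf1, h4⟩
  obtain ⟨x, hx⟩ := hg
  have hx' : a x = g := hx
  have h5 : a (adjoint a (a x)) = a x := congr_arg (fun c : H →L[ℂ] H => c x) h1
  have h6 : a x = ⟪e, x⟫ • f := by rw [he, adjoint_inner_left]; exact h3 x
  have h7 : a e = ((‖e‖ : ℂ) ^ 2) • f := by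
    rw [h3, ← adjoint_inner_left, ← he, inner_self_eq_norm_sq_to_K]
    rfl
  -- The partial isometry identity at `x` now reads `⟪e, x⟫ ‖e‖^2 f = ⟪e, x⟫ f`, which gives `‖e‖ =
  -- 1`.
  rw [h6, map_smul, ← he, map_smul, h7] at h5
  have hne : ⟪e, x⟫ ≠ 0 := fun h0 => hg0' (by rw [← hx', h6, h0, zero_smul])
  have h8 := smul_right_injective H hne h5
  have hf0 : f ≠ 0 := fun h0 => by simp [h0] at hf1
  have h9 : ((‖e‖ : ℂ) ^ 2) = 1 := smul_left_injective ℂ hf0 (by simpa using h8)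
  have h10 : ‖e‖ ^ 2 = 1 := by exact_mod_cast h9
  exact (pow_eq_one_iff_of_nonneg (norm_nonneg e) two_ne_zero).1 h10

omit [CompleteSpace H] in
/-- A property of unit vectors which passes between vectors with non-zero real inner product holds
for all unit vectors as soon as it holds for one. -/
theorem unit_vector_induction {P : H → Prop}
    (h : ∀ x y : H, ‖x‖ = 1 → ‖y‖ = 1 → (⟪x, y⟫).re ≠ 0 → P x → P y) {x y : H}
    (hx : ‖x‖ = 1) (hy : ‖y‖ = 1) (hP : P x) : P y := by
  by_cases h0 : (⟪x, y⟫).re = 0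
  · have h1 : ‖x + y‖ ^ 2 = 2 := by
      have h2 := norm_add_sq (𝕜 := ℂ) x y
      change _ = _ + 2 * (⟪x, y⟫).re + _ at h2
      rw [h2, h0, hx, hy]
      norm_num
    have hne : ‖x + y‖ ≠ 0 := fun h2 => by rw [h2] at h1; norm_num at h1
    have hz : ‖((‖x + y‖⁻¹ : ℝ) : ℂ) • (x + y)‖ = 1 := by
      rw [norm_smul, Complex.norm_real, norm_inv, norm_norm, inv_mul_cancel₀ hne]
    have h0' : (⟪y, x⟫).re = 0 := by rw [← inner_conj_symm, Complex.conj_re, h0]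
    have hs : ∀ z : H, ‖z‖ = 1 → (⟪z, z⟫).re = 1 := fun z hz => by
      rw [inner_self_eq_norm_sq_to_K, hz]
      simp
    refine h _ y hz hy ?_ (h x _ hx hz ?_ hP)
    · rw [inner_smul_left, Complex.conj_ofReal, Complex.re_ofReal_mul, inner_add_left,
        Complex.add_re, h0, hs y hy, zero_add, mul_one]
      exact inv_ne_zero hne
    · rw [inner_smul_right, Complex.re_ofReal_mul, inner_add_right,
        Complex.add_re, h0, hs x hx, add_zero, mul_one]
      exact inv_ne_zero hne
  · exact h x y hx hy h0 hP

omit [CompleteSpace H] in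
theorem re_inner_eq_zero_of_norm_sub_eq {x y : H} (h : ‖x - y‖ = ‖x + y‖) : (⟪x, y⟫).re = 0 := by
  have h1 := norm_add_sq (𝕜 := ℂ) x y
  have h2 := norm_sub_sq (𝕜 := ℂ) x y
  change _ = _ + 2 * (⟪x, y⟫).re + _ at h1
  change _ = _ - 2 * (⟪x, y⟫).re + _ at h2
  rw [h] at h2
  linarith

end Orthogonal

/-! ### Points of the unit circle determined by distances -/

theorem Complex.eq_or_eq_conj_of_norm_sub_one {c l : ℂ} (hc : ‖c‖ = 1) (hl : ‖l‖ = 1)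
    (h : ‖c - 1‖ = ‖l - 1‖) : c = l ∨ c = conj l := by
  have h1 : c.re * c.re + c.im * c.im = 1 := by
    rw [← Complex.normSq_apply, Complex.normSq_eq_norm_sq, hc, one_pow]
  have h2 : l.re * l.re + l.im * l.im = 1 := by
    rw [← Complex.normSq_apply, Complex.normSq_eq_norm_sq, hl, one_pow]
  have h3 : Complex.normSq (c - 1) = Complex.normSq (l - 1) := by
    rw [Complex.normSq_eq_norm_sq, Complex.normSq_eq_norm_sq, h]
  simp only [Complex.normSq_apply, Complex.sub_re, Complex.sub_im, Complex.one_re,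
    Complex.one_im] at h3
  have hre : c.re = l.re := by nlinarith
  have him : (c.im - l.im) * (c.im + l.im) = 0 := by rw [hre] at h1; linarith
  rcases mul_eq_zero.1 him with h4 | h4
  · exact Or.inl (Complex.ext hre (by linarith))
  · exact Or.inr (Complex.ext hre (by rw [Complex.conj_im]; linarith))

theorem Complex.eq_of_norm_sub_I {c l : ℂ} (hc : ‖c‖ = 1) (hl : ‖l‖ = 1)
    (h1 : ‖c - 1‖ = ‖l - 1‖) (h : ‖c - Complex.I‖ = ‖l - Complex.I‖) : c = l := by
  rcases Complex.eq_or_eq_conj_of_norm_sub_one hc hl h1 with rfl | rfl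
  · rfl
  · have h3 : Complex.normSq (conj l - Complex.I) = Complex.normSq (l - Complex.I) := by
      rw [Complex.normSq_eq_norm_sq, Complex.normSq_eq_norm_sq, h]
    simp only [Complex.normSq_apply, Complex.sub_re, Complex.sub_im, Complex.conj_re,
      Complex.conj_im, Complex.I_re, Complex.I_im] at h3
    refine Complex.ext (Complex.conj_re l) ?_
    rw [Complex.conj_im]
    linarith

theorem ofReal_rpow_injective {p x y : ℝ} (hp : 0 < p) (hx : 0 ≤ x) (hy : 0 ≤ y)
    (h : ENNReal.ofReal (x ^ p) = ENNReal.ofReal (y ^ p)) : x = y := by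
  rw [ENNReal.ofReal_eq_ofReal_iff (Real.rpow_nonneg hx p) (Real.rpow_nonneg hy p)] at h
  exact (Real.rpow_left_inj hx hy hp.ne').1 h

/-! ### Orthogonality as a metric property of the sphere -/

section Sphere

variable {H : Type*} [NormedAddCommGroup H] [InnerProductSpace ℂ H] [CompleteSpace H]
  {a b : H →L[ℂ] H} {p : ℝ}

theorem smul_mem_schattenSphere (hp : 0 < p) (hp2 : p ≠ 2) (ha : a ∈ schattenSphere H p) {c : ℂ}
    (hc : ‖c‖ = 1) : c • a ∈ schattenSphere H p := by
  rw [mem_schattenSphere_iff hp] at *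
  exact ⟨ha.1.smul c, by rw [schattenSum_smul_of_norm_eq_one ha.1 hp hp2 hc, ha.2]⟩

theorem neg_mem_schattenSphere (hp : 0 < p) (hp2 : p ≠ 2) (ha : a ∈ schattenSphere H p) :
    -a ∈ schattenSphere H p := by
  have h := smul_mem_schattenSphere hp hp2 ha (c := -1) (by simp)
  rwa [neg_one_smul] at h

theorem rankOne_mem_schattenSphere (hp : 0 < p) (hp2 : p ≠ 2) {x y : H} (hx : ‖x‖ = 1)
    (hy : ‖y‖ = 1) : rankOne ℂ x y ∈ schattenSphere H p := by
  rw [mem_schattenSphere_iff hp]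
  exact ⟨isCompactOperator_rankOne x y, by rw [schattenSum_rankOne hp hp2, hx, hy]; simp⟩

theorem schattenSum_smul_sub (hp : 0 < p) (hp2 : p ≠ 2) (ha : a ∈ schattenSphere H p) (c d : ℂ) :
    schattenSum p (c • a - d • a) = ENNReal.ofReal (‖c - d‖ ^ p) := by
  rw [mem_schattenSphere_iff hp] at ha
  rw [← sub_smul, schattenSum_smul ha.1 hp hp2, ha.2, mul_one]

theorem schattenSum_clarkson_of_orthogonal (hp : 0 < p) (hp2 : p ≠ 2)
    (ha : a ∈ schattenSphere H p) (hb : b ∈ schattenSphere H p) (h1 : b ∘L adjoint a = 0)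
    (h2 : adjoint b ∘L a = 0) : schattenSum p (a + b) + schattenSum p (a - b) = 4 := by
  have hb' := neg_mem_schattenSphere hp hp2 hb
  rw [mem_schattenSphere_iff hp] at ha hb hb'
  rw [sub_eq_add_neg, schattenSum_add_of_orthogonal ha.1 hb.1 hp hp2 h1 h2,
    schattenSum_add_of_orthogonal ha.1 hb'.1 hp hp2 (by rw [neg_comp, h1, neg_zero])
      (by rw [map_neg, neg_comp, h2, neg_zero]), ha.2, hb.2, hb'.2]
  norm_num

theorem orthogonal_of_schattenSum_clarkson (hp : 0 < p) (hp2 : p ≠ 2)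
    (ha : a ∈ schattenSphere H p) (hb : b ∈ schattenSphere H p)
    (h : schattenSum p (a + b) + schattenSum p (a - b) = 4) :
    b ∘L adjoint a = 0 ∧ adjoint b ∘L a = 0 := by
  rw [mem_schattenSphere_iff hp] at ha hb
  have hfin : schattenSum p a + schattenSum p b ≠ ∞ := by
    rw [ha.2, hb.2]
    norm_num
  have h' : schattenSum p (a + b) + schattenSum p (a - b) =
      2 * (schattenSum p a + schattenSum p b) := by
    rw [h, ha.2, hb.2]
    norm_num
  exact ⟨comp_adjoint_eq_zero_of_clarkson ha.1 hb.1 hp hp2 hfin h',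
    adjoint_comp_eq_zero_of_clarkson ha.1 hb.1 hp hp2 hfin h'⟩

end Sphere

/-! ### Surjective isometries between the spheres -/

namespace IsSurjectiveSphereIsometry

variable {H : Type*} [NormedAddCommGroup H] [InnerProductSpace ℂ H] [CompleteSpace H]
  {K : Type*} [NormedAddCommGroup K] [InnerProductSpace ℂ K] [CompleteSpace K]
  {p : ℝ} {Δ : (H →L[ℂ] H) → (K →L[ℂ] K)} {a b : H →L[ℂ] H}

theorem schattenSum_sub (hΔ : IsSurjectiveSphereIsometry p Δ) (hp : 0 < p)
    (ha : a ∈ schattenSphere H p) (hb : b ∈ schattenSphere H p) :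
    schattenSum p (Δ a - Δ b) = schattenSum p (a - b) :=
  ENNReal.rpow_left_injective (one_div_pos.2 hp).ne' (hΔ.isometry a ha b hb)

theorem map_neg (hΔ : IsSurjectiveSphereIsometry p Δ) (hp : 1 < p) (hp2 : p ≠ 2)
    (ha : a ∈ schattenSphere H p) : Δ (-a) = -Δ a := by
  have hp0 : 0 < p := by linarith
  have ha' := neg_mem_schattenSphere hp0 hp2 ha
  have h1 := hΔ.schattenSum_sub hp0 ha ha'
  have h2 := schattenSum_smul_sub hp0 hp2 ha 1 (-1)
  rw [one_smul, neg_one_smul] at h2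
  rw [h2] at h1
  have h3 := (mem_schattenSphere_iff hp0).1 (hΔ.mapsTo ha)
  have h4 := (mem_schattenSphere_iff hp0).1 (hΔ.mapsTo ha')
  refine eq_neg_of_schattenSum_sub hp hp2 h3.1 h4.1 h3.2 h4.2 (h1.trans ?_)
  norm_num

theorem schattenSum_add (hΔ : IsSurjectiveSphereIsometry p Δ) (hp : 1 < p) (hp2 : p ≠ 2)
    (ha : a ∈ schattenSphere H p) (hb : b ∈ schattenSphere H p) :
    schattenSum p (Δ a + Δ b) = schattenSum p (a + b) := by
  have hp0 : 0 < p := by linarith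
  have h := hΔ.schattenSum_sub hp0 ha (neg_mem_schattenSphere hp0 hp2 hb)
  rwa [hΔ.map_neg hp hp2 hb, sub_neg_eq_add, sub_neg_eq_add] at h

/-- Orthogonality to a rank-one operator passes from `v` to `Δ v`, then to `l Δ v`, and back to the
preimage `w`; what is orthogonal to everything orthogonal to `v` is a multiple of `v`. -/
theorem exists_preimage_smul (hΔ : IsSurjectiveSphereIsometry p Δ) (hp : 1 < p) (hp2 : p ≠ 2)
    {e f : H} (he : ‖e‖ = 1) (hf : ‖f‖ = 1) {l : ℂ} (hl : ‖l‖ = 1) :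
    ∃ c : ℂ, ‖c‖ = 1 ∧ Δ (c • rankOne ℂ f e) = l • Δ (rankOne ℂ f e) := by
  have hp0 : 0 < p := by linarith
  have hv : rankOne ℂ f e ∈ schattenSphere H p := rankOne_mem_schattenSphere hp0 hp2 hf he
  have hlv := smul_mem_schattenSphere hp0 hp2 (hΔ.mapsTo hv) hl
  obtain ⟨w, hw, hwl⟩ := hΔ.surjOn hlv
  have key : ∀ e' f' : H, ‖e'‖ = 1 → ‖f'‖ = 1 → ⟪e, e'⟫ = 0 → ⟪f, f'⟫ = 0 →
      w e' = 0 ∧ adjoint w f' = 0 := by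
    intro e' f' he' hf' hee hff
    have hy : rankOne ℂ f' e' ∈ schattenSphere H p := rankOne_mem_schattenSphere hp0 hp2 hf' he'
    have h1 := schattenSum_clarkson_of_orthogonal hp0 hp2 hv hy
      (by
        ext x
        simp [adjoint_rankOne, inner_eq_zero_symm.1 hee])
      (by
        ext x
        simp [adjoint_rankOne, inner_eq_zero_symm.1 hff])
    rw [← hΔ.schattenSum_add hp hp2 hv hy, ← hΔ.schattenSum_sub hp0 hv hy] at h1
    obtain ⟨h2, h3⟩ :=
      orthogonal_of_schattenSum_clarkson hp0 hp2 (hΔ.mapsTo hv) (hΔ.mapsTo hy) h1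
    have h4 := schattenSum_clarkson_of_orthogonal hp0 hp2 hlv (hΔ.mapsTo hy)
      (by rw [LinearIsometryEquiv.map_smulₛₗ, comp_smul, h2, smul_zero])
      (by rw [comp_smul, h3, smul_zero])
    rw [← hwl, hΔ.schattenSum_add hp hp2 hw hy, hΔ.schattenSum_sub hp0 hw hy] at h4
    obtain ⟨h5, h6⟩ := orthogonal_of_schattenSum_clarkson hp0 hp2 hw hy h4
    have he0 : e' ≠ 0 := fun h0 => by simp [h0] at he'
    have hf0 : f' ≠ 0 := fun h0 => by simp [h0] at hf'
    constructor
    · rw [← inner_self_eq_zero (𝕜 := ℂ), ← adjoint_inner_right]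
      have h7 : rankOne ℂ f' e' (adjoint w (w e')) = 0 :=
        congr_arg (fun c : H →L[ℂ] H => c (w e')) h5
      rw [rankOne_apply] at h7
      exact (smul_eq_zero.1 h7).resolve_right hf0
    · rw [← inner_self_eq_zero (𝕜 := ℂ), adjoint_inner_left]
      have h7 : adjoint (rankOne ℂ f' e') (w (adjoint w f')) = 0 :=
        congr_arg (fun c : H →L[ℂ] H => c (adjoint w f')) h6
      rw [adjoint_rankOne, rankOne_apply] at h7
      exact (smul_eq_zero.1 h7).resolve_right he0
  obtain ⟨c, rfl⟩ := eq_smul_rankOne he hf key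
  refine ⟨c, ?_, hwl⟩
  have h8 := ((mem_schattenSphere_iff hp0).1 hw).2
  rw [schattenSum_smul (isCompactOperator_rankOne f e) hp0 hp2,
    ((mem_schattenSphere_iff hp0).1 hv).2, mul_one] at h8
  refine ofReal_rpow_injective hp0 (norm_nonneg c) zero_le_one ?_
  rw [h8, Real.one_rpow, ENNReal.ofReal_one]

theorem norm_sub_eq_of_map_smul (hΔ : IsSurjectiveSphereIsometry p Δ) (hp : 0 < p) (hp2 : p ≠ 2)
    (ha : a ∈ schattenSphere H p) {c d l m : ℂ} (hc : ‖c‖ = 1) (hd : ‖d‖ = 1)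
    (hcl : Δ (c • a) = l • Δ a) (hdm : Δ (d • a) = m • Δ a) : ‖c - d‖ = ‖l - m‖ := by
  have h1 := hΔ.schattenSum_sub hp (smul_mem_schattenSphere hp hp2 ha hc)
    (smul_mem_schattenSphere hp hp2 ha hd)
  rw [hcl, hdm, schattenSum_smul_sub hp hp2 (hΔ.mapsTo ha), schattenSum_smul_sub hp hp2 ha] at h1
  exact ofReal_rpow_injective hp (norm_nonneg _) (norm_nonneg _) h1.symm

theorem map_smul_rankOne (hΔ : IsSurjectiveSphereIsometry p Δ) (hp : 1 < p) (hp2 : p ≠ 2)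
    {e f : H} (he : ‖e‖ = 1) (hf : ‖f‖ = 1) :
    (∀ c : ℂ, ‖c‖ = 1 → Δ (c • rankOne ℂ f e) = c • Δ (rankOne ℂ f e)) ∨
    (∀ c : ℂ, ‖c‖ = 1 → Δ (c • rankOne ℂ f e) = conj c • Δ (rankOne ℂ f e)) := by
  have hp0 : 0 < p := by linarith
  have hv : rankOne ℂ f e ∈ schattenSphere H p := rankOne_mem_schattenSphere hp0 hp2 hf he
  have h1 : Δ ((1 : ℂ) • rankOne ℂ f e) = (1 : ℂ) • Δ (rankOne ℂ f e) := by
    rw [one_smul, one_smul]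
  have hconj : ∀ c : ℂ, ‖conj c‖ = ‖c‖ := fun c => RCLike.norm_conj c
  -- The preimage of `i Δ v` is `d v` with `d = i` or `d = -i`. This decides the type, since a point
  -- of the circle is determined by its distances to `1` and `i`.
  obtain ⟨d, hd, hdI⟩ := hΔ.exists_preimage_smul hp hp2 he hf Complex.norm_I
  have hdn := hΔ.norm_sub_eq_of_map_smul hp0 hp2 hv hd norm_one hdI h1
  rcases Complex.eq_or_eq_conj_of_norm_sub_one hd Complex.norm_I hdn with rfl | rfl
  · refine Or.inl fun l hl => ?_
    obtain ⟨c, hc, hcl⟩ := hΔ.exists_preimage_smul hp hp2 he hf hl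
    have h2 := hΔ.norm_sub_eq_of_map_smul hp0 hp2 hv hc norm_one hcl h1
    have h3 := hΔ.norm_sub_eq_of_map_smul hp0 hp2 hv hc hd hcl hdI
    rwa [Complex.eq_of_norm_sub_I hc hl h2 h3] at hcl
  · refine Or.inr fun l hl => ?_
    -- Start from the target `conj l`; conjugating the distances shows that its preimage is `l`.
    obtain ⟨c, hc, hcl⟩ := hΔ.exists_preimage_smul hp hp2 he hf ((hconj l).trans hl)
    have h2 := hΔ.norm_sub_eq_of_map_smul hp0 hp2 hv hc norm_one hcl h1
    have h3 := hΔ.norm_sub_eq_of_map_smul hp0 hp2 hv hc hd hcl hdI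
    rw [← hconj (conj l - 1), map_sub, Complex.conj_conj, map_one] at h2
    rw [← hconj (c - _), map_sub, Complex.conj_conj] at h3
    rw [← hconj (c - 1), map_sub, map_one] at h2
    have h4 : conj c = conj l := by
      refine Complex.eq_of_norm_sub_I ((hconj c).trans hc) ((hconj l).trans hl) ?_ h3
      rw [h2, ← hconj (l - 1), map_sub, map_one]
    rwa [(starRingEnd ℂ).injective h4] at hcl

theorem false_of_linear_of_conjLinear (hΔ : IsSurjectiveSphereIsometry p Δ) (hp : 0 < p)
    (hp2 : p ≠ 2) (ha : a ∈ schattenSphere H p) (h1 : Δ (Complex.I • a) = Complex.I • Δ a)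
    (h2 : Δ (Complex.I • a) = conj Complex.I • Δ a) : False := by
  have h3 := hΔ.norm_sub_eq_of_map_smul hp hp2 ha Complex.norm_I Complex.norm_I h1 h2
  rw [sub_self, norm_zero, Complex.conj_I, sub_neg_eq_add, ← two_mul, norm_mul,
    Complex.norm_I] at h3
  norm_num at h3

/-- Since `Δ (i a) - Δ (i b) = i (Δ a + Δ b)`, the distance from `i a` to `i b` equals `‖Δ a + Δ
b‖`, which is `‖a + b‖` because `Δ` is odd. -/
theorem schattenSum_sub_eq_add (hΔ : IsSurjectiveSphereIsometry p Δ) (hp : 1 < p) (hp2 : p ≠ 2)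
    (ha : a ∈ schattenSphere H p) (hb : b ∈ schattenSphere H p)
    (h1 : Δ (Complex.I • a) = Complex.I • Δ a)
    (h2 : Δ (Complex.I • b) = conj Complex.I • Δ b) :
    schattenSum p (a - b) = schattenSum p (a + b) := by
  have hp0 : 0 < p := by linarith
  have h3 := hΔ.schattenSum_sub hp0 (smul_mem_schattenSphere hp0 hp2 ha Complex.norm_I)
    (smul_mem_schattenSphere hp0 hp2 hb Complex.norm_I)
  have ha1 := ((mem_schattenSphere_iff hp0).1 ha).1
  have hb1 := ((mem_schattenSphere_iff hp0).1 hb).1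
  have ha2 := ((mem_schattenSphere_iff hp0).1 (hΔ.mapsTo ha)).1
  have hb2 := ((mem_schattenSphere_iff hp0).1 (hΔ.mapsTo hb)).1
  rw [h1, h2, Complex.conj_I, neg_smul, sub_neg_eq_add, ← smul_add, ← smul_sub,
    schattenSum_smul_of_norm_eq_one (ha2.add hb2) hp0 hp2 Complex.norm_I,
    schattenSum_smul_of_norm_eq_one (ha1.sub hb1) hp0 hp2 Complex.norm_I,
    hΔ.schattenSum_add hp hp2 ha hb] at h3
  exact h3.symm

/-- One vector is changed at a time: operators sharing a vector have rank-one sum and difference,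
whose norms are those of `x + y` and `x - y`. -/
theorem linear_of_linear (hΔ : IsSurjectiveSphereIsometry p Δ) (hp : 1 < p) (hp2 : p ≠ 2)
    {e f e' f' : H} (he : ‖e‖ = 1) (hf : ‖f‖ = 1) (he' : ‖e'‖ = 1) (hf' : ‖f'‖ = 1)
    (h : ∀ c : ℂ, ‖c‖ = 1 → Δ (c • rankOne ℂ f e) = c • Δ (rankOne ℂ f e)) :
    ∀ c : ℂ, ‖c‖ = 1 → Δ (c • rankOne ℂ f' e') = c • Δ (rankOne ℂ f' e') := by
  have hp0 : 0 < p := by linarith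
  have h1 : ∀ c : ℂ, ‖c‖ = 1 → Δ (c • rankOne ℂ f' e) = c • Δ (rankOne ℂ f' e) := by
    refine unit_vector_induction (P := fun x => ∀ c : ℂ, ‖c‖ = 1 →
      Δ (c • rankOne ℂ x e) = c • Δ (rankOne ℂ x e)) (fun x y hx hy hxy hP => ?_) hf hf' h
    refine (hΔ.map_smul_rankOne hp hp2 he hy).resolve_right fun hQ => hxy ?_
    have h2 := hΔ.schattenSum_sub_eq_add hp hp2 (rankOne_mem_schattenSphere hp0 hp2 hx he)
      (rankOne_mem_schattenSphere hp0 hp2 hy he) (hP _ Complex.norm_I) (hQ _ Complex.norm_I)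
    have h3 : rankOne ℂ x e - rankOne ℂ y e = rankOne ℂ (x - y) e := by ext; simp
    have h4 : rankOne ℂ x e + rankOne ℂ y e = rankOne ℂ (x + y) e := by ext; simp
    rw [h3, h4, schattenSum_rankOne hp0 hp2, schattenSum_rankOne hp0 hp2, he, mul_one,
      mul_one] at h2
    exact re_inner_eq_zero_of_norm_sub_eq
      (ofReal_rpow_injective hp0 (norm_nonneg _) (norm_nonneg _) h2)
  refine unit_vector_induction (P := fun x => ∀ c : ℂ, ‖c‖ = 1 →
    Δ (c • rankOne ℂ f' x) = c • Δ (rankOne ℂ f' x)) (fun x y hx hy hxy hP => ?_) he he' h1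
  refine (hΔ.map_smul_rankOne hp hp2 hy hf').resolve_right fun hQ => hxy ?_
  have h2 := hΔ.schattenSum_sub_eq_add hp hp2 (rankOne_mem_schattenSphere hp0 hp2 hf' hx)
    (rankOne_mem_schattenSphere hp0 hp2 hf' hy) (hP _ Complex.norm_I) (hQ _ Complex.norm_I)
  have h3 : rankOne ℂ f' x - rankOne ℂ f' y = rankOne ℂ f' (x - y) := by
    ext; simp
  have h4 : rankOne ℂ f' x + rankOne ℂ f' y = rankOne ℂ f' (x + y) := by
    ext; simp
  rw [h3, h4, schattenSum_rankOne hp0 hp2, schattenSum_rankOne hp0 hp2, hf', one_mul,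
    one_mul] at h2
  exact re_inner_eq_zero_of_norm_sub_eq
    (ofReal_rpow_injective hp0 (norm_nonneg _) (norm_nonneg _) h2)

end IsSurjectiveSphereIsometry

theorem rankOne_mem_minimalPartialIsometries {H : Type*} [NormedAddCommGroup H]
    [InnerProductSpace ℂ H] [CompleteSpace H] {e f : H} (he : ‖e‖ = 1) (hf : ‖f‖ = 1) :
    rankOne ℂ f e ∈ minimalPartialIsometries H := by
  have hf0 : f ≠ 0 := fun h0 => by simp [h0] at hf
  refine ⟨?_, ?_⟩
  · rw [star_eq_adjoint, adjoint_rankOne]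
    ext x
    simp [he, hf]
  · have h1 : LinearMap.range (rankOne ℂ f e : H →ₗ[ℂ] H) = Submodule.span ℂ {f} := by
      refine le_antisymm ?_ ?_
      · rintro _ ⟨x, rfl⟩
        exact Submodule.smul_mem _ _ (Submodule.mem_span_singleton_self f)
      · rw [Submodule.span_singleton_le_iff_mem]
        exact ⟨e, by simp [he]⟩
    rw [h1, finrank_span_singleton hf0]

end

theorem propositionp
    {H : Type*} [NormedAddCommGroup H] [InnerProductSpace ℂ H] [CompleteSpace H] [Nontrivial H]
    {H' : Type*} [NormedAddCommGroup H'] [InnerProductSpace ℂ H'] [CompleteSpace H']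
    (p : ℝ) (hp : 1 < p) (hp2 : p ≠ 2)
    (Δ : (H →L[ℂ] H) → (H' →L[ℂ] H')) (hΔ : IsSurjectiveSphereIsometry p Δ) :
    Xor
      (∀ c : ℂ, ‖c‖ = 1 → ∀ v ∈ minimalPartialIsometries H, Δ (c • v) = c • Δ v)
      (∀ c : ℂ, ‖c‖ = 1 → ∀ v ∈ minimalPartialIsometries H, Δ (c • v) = conj c • Δ v) := by
  obtain ⟨e, he⟩ := exists_norm_eq H zero_le_one
  have hp0 : 0 < p := by linarith
  have hmem := rankOne_mem_schattenSphere hp0 hp2 he he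
  have hmin := rankOne_mem_minimalPartialIsometries he he
  have hI := Complex.norm_I
  rcases hΔ.map_smul_rankOne hp hp2 he he with h | h
  · refine Or.inl ⟨fun c hc v hv => ?_, fun hno => ?_⟩
    · obtain ⟨e', f', he', hf', rfl⟩ := exists_eq_rankOne_of_mem_minimalPartialIsometries hv
      exact hΔ.linear_of_linear hp hp2 he he he' hf' h c hc
    · exact hΔ.false_of_linear_of_conjLinear hp0 hp2 hmem (h _ hI) (hno _ hI _ hmin)
  · refine Or.inr ⟨fun c hc v hv => ?_, fun hno => ?_⟩
    · obtain ⟨e', f', he', hf', rfl⟩ := exists_eq_rankOne_of_mem_minimalPartialIsometries hv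
      refine (hΔ.map_smul_rankOne hp hp2 he' hf').resolve_left (fun h' => ?_) c hc
      exact hΔ.false_of_linear_of_conjLinear hp0 hp2 hmem
        (hΔ.linear_of_linear hp hp2 he' hf' he he h' _ hI) (h _ hI)
    · exact hΔ.false_of_linear_of_conjLinear hp0 hp2 hmem (hno _ hI _ hmin) (h _ hI)
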